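/- Let $n\ge 1$, let $\gamma=(\gamma_1,\dots,\gamma_n)$ with all $\gamma_i>0$, $|\gamma|=\gamma_1+\dots+\gamma_n$, and let $\lambda>0$. Put $\mathbb{R}_n^+=\{x\in\mathbb{R}^n: x_1>0,\dots,x_n>0\}$, $x^\gamma=\prod_i x_i^{\gamma_i}$, $S_1^+(n)=\{x\in\mathbb{R}_n^+:|x|=1\}$ with surface measure $dS$, and $|S_1^+(n)|_\gamma=\int_{S_1^+(n)}\xi^\gamma\,dS(\xi)$. Let $\mathbf{j}_\gamma(x,\xi)=\prod_{i=1}^n j_{(\gamma_i-1)/2}(x_i\xi_i)$, where $j_\omega(t)=\Gamma(\omega+1)(2/t)^\omega J_\omega(t)$ for $t>0$ (extended by $j_\omega(0)=1$) is the normalized Bessel function. The Fourier–Bessel (Hankel) transform of $F$ is $$\widehat F(\xi)=\int_{\mathbb{R}_n^+}\mathbf{j}_\gamma(x,\xi)\,F(x)\,x^\gamma\,dx,$$ and the multidimensional generalized translation is $$(T^{y}f)(x)=\prod_{i=1}^n\frac{\Gamma(\frac{\gamma_i+1}{2})}{\sqrt\pi\,\Gamma(\frac{\gamma_i}{2})}\int_{(0,\pi)^n}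 f\Big(\big(\sqrt{x_i^2+y_i^2-2x_iy_i\cos\varphi_i}\,\big)_{i=1}^n\Big)\prod_{i=1}^n\sin^{\gamma_i-1}\varphi_i\,d\varphi .$$ Theorem. Let $F:\mathbb{R}_n^+\to\mathbb{C}$ be continuous with $\int_{\mathbb{R}_n^+}|F(x)|\,x^\gamma\,dx<\infty$ (in particular, $F$ may be any Schwartz function even in each variable), and suppose that $\widehat F$ vanishes at all points of $\mathbb{R}_n^+$ outside the part $\{x\in\mathbb{R}_n^+:|x|<2\lambda\}$ of the ball. For $y\in\mathbb{R}_n^+$ set $$f_y(x)=\frac{|x|\,\widehat F(x)\,\mathbf{j}_\gamma(x,y)}{(4\lambda^2-|x|^2)^{\frac{n+|\gamma|-3}{2}}},\qquad |x|<2\lambda,$$ and $f_y(x)=0$ for $|x|\ge2\lambda$. Then for every $y\in\mathbb{R}_n^+$ the integral defining $(T^{\lambda\zeta}f_y)(\lambda\xi)$ converges absolutely for almost all $(\zeta,\xi)\in S_1^+(n)\times S_1^+(n)$, the function $(T^{\lambda\zeta}f_y)(\lambda\xi)\,\zeta^\gamma\xi^\gamma$ is integrable over $S_1^+(n)\times S_1^+(n)$,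 and $$F(y)=C(n,\gamma)\int_{S_1^+(n)}\int_{S_1^+(n)}(T^{\lambda\zeta}f_y)(\lambda\xi)\,\zeta^\gamma\xi^\gamma\,dS(\xi)\,dS(\zeta),$$ $$C(n,\gamma)=\frac{\sqrt\pi\,2^{\,n-2}\,\lambda^{2n+2|\gamma|-4}\,\Gamma\!\left(\frac{|\gamma|+n-1}{2}\right)}{\Gamma^2\!\left(\frac{n+|\gamma|}{2}\right)\prod_{j=1}^n\Gamma\!\left(\frac{\gamma_j+1}{2}\right)|S_1^+(n)|_\gamma^2}.$$ -/

import Mathlib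

open MeasureTheory Set

namespace FourierBessel

noncomputable section

/-- The open positive orthant `ℝ_n^+ = {x ∈ ℝⁿ : x₁ > 0, …, x_n > 0}`. -/
def orthant (n : ℕ) : Set (EuclideanSpace ℝ (Fin n)) :=
  {x | ∀ i, 0 < x i}

/-- The part of the open ball `|x| < r` lying in the positive orthant. -/
def orthantBall (n : ℕ) (r : ℝ) : Set (EuclideanSpace ℝ (Fin n)) :=
  {x | x ∈ orthant n ∧ ‖x‖ < r}

/-- The weight `x^γ = ∏ x_i ^ γ_i`. -/
def weight {n : ℕ} (γ : Fin n → ℝ) (x : EuclideanSpace ℝ (Fin n)) : ℝ :=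
  ∏ i, x i ^ γ i

/-- The Bessel function of the first kind `J_ω` (for arguments `t > 0`), by its series. -/
def besselJ (ω t : ℝ) : ℝ :=
  ∑' k : ℕ, (-1) ^ k / ((k.factorial : ℝ) * Real.Gamma (k + ω + 1)) *
    (t / 2) ^ (2 * (k : ℝ) + ω)

/-- The normalized ("small") Bessel function `j_ω`, the even entire function with `j_ω(0) = 1` that
for `t > 0` is `Γ(ω + 1) (2 / t)^ω J_ω(t)`, see `smallBessel_eq`. -/
def smallBessel (ω t : ℝ) : ℝ :=
  Real.Gamma (ω + 1) *
    ∑' k : ℕ, (-1) ^ k / ((k.factorial : ℝ) * Real.Gamma (k + ω + 1)) * (t / 2) ^ (2 * k)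

theorem smallBessel_eq (ω : ℝ) {t : ℝ} (ht : 0 < t) :
    smallBessel ω t = Real.Gamma (ω + 1) * (2 / t) ^ ω * besselJ ω t := by
  have h2 : 0 < t / 2 := by positivity
  rw [smallBessel, besselJ, mul_assoc]
  congr 1
  rw [← tsum_mul_left]
  refine tsum_congr fun k => ?_
  have e : (2 / t) ^ ω = ((t / 2) ^ ω)⁻¹ := by
    rw [← Real.inv_rpow h2.le, inv_div]
  have e2 : (t / 2) ^ (2 * (k : ℝ)) = (t / 2) ^ (2 * k) := by
    rw [← Real.rpow_natCast]
    push_cast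
    rfl
  have e3 : (t / 2) ^ ω ≠ 0 := (Real.rpow_pos_of_pos h2 ω).ne'
  rw [Real.rpow_add h2, e2, e]
  field_simp

/-- The kernel `𝐣_γ(x, ξ) = ∏ j_{(γ_i - 1)/2}(x_i ξ_i)`. -/
def besselKernel {n : ℕ} (γ : Fin n → ℝ) (x ξ : EuclideanSpace ℝ (Fin n)) : ℝ :=
  ∏ i, smallBessel ((γ i - 1) / 2) (x i * ξ i)

/-- The Fourier–Bessel (Hankel) transform `∫_{ℝ_n^+} 𝐣_γ(x, ξ) f(x) x^γ dx`. -/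
def fourierBessel {n : ℕ} (γ : Fin n → ℝ) (f : EuclideanSpace ℝ (Fin n) → ℂ)
    (ξ : EuclideanSpace ℝ (Fin n)) : ℂ :=
  ∫ x in orthant n, ((besselKernel γ x ξ * weight γ x : ℝ) : ℂ) * f x

/-- The one-dimensional generalized translation `{}^ν𝒯_s^t g(s)`. -/
def translation₁ (ν : ℝ) (g : ℝ → ℂ) (t s : ℝ) : ℂ :=
  ((Real.Gamma ((ν + 1) / 2) / (√Real.pi * Real.Gamma (ν / 2)) : ℝ) : ℂ) *
    ∫ φ in Ioo 0 Real.pi,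
      ((Real.sin φ ^ (ν - 1) : ℝ) : ℂ) * g (√(s ^ 2 + t ^ 2 - 2 * s * t * Real.cos φ))

/-- The point with coordinates `√(x_i² + y_i² - 2 x_i y_i cos φ_i)`. -/
def translationPoint {n : ℕ} (x y : EuclideanSpace ℝ (Fin n)) (φ : Fin n → ℝ) :
    EuclideanSpace ℝ (Fin n) :=
  WithLp.toLp 2 fun i => √(x i ^ 2 + y i ^ 2 - 2 * x i * y i * Real.cos (φ i))

/-- The integrand of the multidimensional generalized translation. -/
def translationIntegrand {n : ℕ} (γ : Fin n → ℝ) (f : EuclideanSpace ℝ (Fin n) → ℂ)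
    (y x : EuclideanSpace ℝ (Fin n)) (φ : Fin n → ℝ) : ℂ :=
  ((∏ i, Real.sin (φ i) ^ (γ i - 1) : ℝ) : ℂ) * f (translationPoint x y φ)

/-- The cube `(0, π)ⁿ` of angles. -/
def angleCube (n : ℕ) : Set (Fin n → ℝ) :=
  Set.pi Set.univ fun _ => Ioo 0 Real.pi

/-- The multidimensional generalized translation `(T^y f)(x)`: the one-dimensional generalized
translation with parameter `γ_i`, shift `y_i` acts in each coordinate `x_i`, written as one multiple
integral over the angles. -/
def translation {n : ℕ} (γ : Fin n → ℝ) (f : EuclideanSpace ℝ (Fin n) → ℂ)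
    (y x : EuclideanSpace ℝ (Fin n)) : ℂ :=
  ((∏ i, Real.Gamma ((γ i + 1) / 2) / (√Real.pi * Real.Gamma (γ i / 2)) : ℝ) : ℂ) *
    ∫ φ in angleCube n, translationIntegrand γ f y x φ

/-- On products of functions of one variable, `T^y` acts by the one-dimensional translations. -/
theorem translation_prod {n : ℕ} (γ : Fin n → ℝ) (g : Fin n → ℝ → ℂ)
    (y x : EuclideanSpace ℝ (Fin n)) :
    translation γ (fun z => ∏ i, g i (z i)) y x = ∏ i, translation₁ (γ i) (g i) (y i) (x i) := by
  simp only [translation, translation₁, translationIntegrand, translationPoint, angleCube]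
  rw [Finset.prod_mul_distrib, volume_pi, Measure.restrict_pi_pi,
    ← integral_fintype_prod_eq_prod]
  push_cast
  simp only [Finset.prod_mul_distrib]

/-- The surface measure `dS` on the unit sphere, restricted to its part `S_1^+(n)` in the positive
orthant. -/
def sphereMeasure (n : ℕ) :
    Measure (Metric.sphere (0 : EuclideanSpace ℝ (Fin n)) 1) :=
  (volume : Measure (EuclideanSpace ℝ (Fin n))).toSphere.restrict {ξ | ξ.1 ∈ orthant n}

/-- The weighted area `|S_1^+(n)|_γ = ∫_{S_1^+(n)} ξ^γ dS(ξ)`. -/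
def sphereArea {n : ℕ} (γ : Fin n → ℝ) : ℝ :=
  ∫ ξ, weight γ ξ.1 ∂(sphereMeasure n)

/-- The function `x ↦ |x| G(x) 𝐣_γ(x, y) / (4λ² - |x|²)^{(n + |γ| - 3)/2}`. -/
def ewaldFunction {n : ℕ} (γ : Fin n → ℝ) (lam : ℝ) (G : EuclideanSpace ℝ (Fin n) → ℂ)
    (y x : EuclideanSpace ℝ (Fin n)) : ℂ :=
  (‖x‖ : ℂ) * G x * (besselKernel γ x y : ℂ) /
    (((4 * lam ^ 2 - ‖x‖ ^ 2) ^ ((n + ∑ i, γ i - 3) / 2) : ℝ) : ℂ)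

/-- The constant `C(n, γ)` (it also depends on the radius `λ`). -/
def inversionConstant {n : ℕ} (γ : Fin n → ℝ) (lam : ℝ) : ℝ :=
  √Real.pi * 2 ^ ((n : ℝ) - 2) * lam ^ (2 * n + 2 * ∑ i, γ i - 4) *
      Real.Gamma ((∑ i, γ i + n - 1) / 2) /
    (Real.Gamma ((n + ∑ i, γ i) / 2) ^ 2 * (∏ i, Real.Gamma ((γ i + 1) / 2)) *
      sphereArea γ ^ 2)

end

end FourierBessel

open FourierBessel

namespace FourierBessel

noncomputable section

/-! Write `p = n + |γ| - 1` and `A = |S_1^+(n)|_γ`. Distribute `ζ` and `ξ` on the sphere by `ζ^γ dS`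
and `ξ^γ dS`, and the angles `φ_i` independently with densities proportional to `sin^(γ_i - 1)`. The
double integral of the translation is then the integral of `f_y` over the law of the point with
coordinates `λ √(ξ_i² + ζ_i² - 2 ξ_i ζ_i cos φ_i)`. The core of the proof is the computation of this
law in `map_sphereTranslationPoint`: it is isotropic relative to `x^γ dx`, with density a constant
times `|x|⁻¹ (4λ² - |x|²)^((n + |γ| - 3)/2)` on `|x| < 2λ`. The factors in `f_y` cancel this density
(`chordDensity_smul_ewaldFunction`), and what remains is the inverse Fourier–Bessel integral of `F̂`
at `y`, evaluated by `integral_besselKernel_smul_fourierBessel`.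

The law is identified by its Fourier–Bessel transform, which determines finite measures on the
orthant (`ext_of_integral_besselKernel`). By the product formula `integral_smallBessel_chord`,
averaging the kernel over the angles gives a product of two kernels, so the transform at `η` is the
square of a spherical mean. That mean is `A j_{(p-1)/2}(λ|η|)` by
`integral_weightedSphere_besselKernel`. The product formula, now with the single parameter `p` and
read backwards, writes `j_{(p-1)/2}(λ|η|)²` as an average of `j_{(p-1)/2}(ρ|η|)` over chords `ρ = 2λ
sin(φ/2)`. Hence the law is `A` times that of `ρθ` with `θ` on the weighted sphere, and the
substitution in `lintegral_chord` produces its density.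

The product formula is a comparison of power series, resting on a Chu–Vandermonde sum. Most other
ingredients come from Gaussians: polar coordinates in a half-plane give Weber's integrals, Gaussians
separate finite measures on the orthant, and translated Gaussians form the approximate identity
behind the inversion formula. -/

/-! ### One-dimensional measures -/

/-- The normalizing constant of the generalized translation. -/
def angleConst (γ : ℝ) : ℝ :=
  Real.Gamma ((γ + 1) / 2) / (√Real.pi * Real.Gamma (γ / 2))

/-- The probability measure with density proportional to `sin φ ^ (γ - 1)` on `(0, π)`. -/
def angleMeasure (γ : ℝ) : Measure ℝ :=
  (volume.restrict (Ioo 0 Real.pi)).withDensity fun φ =>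
    ENNReal.ofReal (angleConst γ * Real.sin φ ^ (γ - 1))

/-- The measure `r ^ γ dr` on the half-line. -/
def radialMeasure (γ : ℝ) : Measure ℝ :=
  (volume.restrict (Ioi 0)).withDensity fun r => ENNReal.ofReal (r ^ γ)

theorem angleConst_pos {γ : ℝ} (hγ : 0 < γ) : 0 < angleConst γ := by
  have := Real.Gamma_pos_of_pos (show 0 < (γ + 1) / 2 by positivity)
  have := Real.Gamma_pos_of_pos (show 0 < γ / 2 by positivity)
  have := Real.pi_pos
  unfold angleConst
  positivity

theorem angleDensity_nonneg {γ : ℝ} (hγ : 0 < γ) {φ : ℝ} (hφ : φ ∈ Ioo 0 Real.pi) :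
    0 ≤ angleConst γ * Real.sin φ ^ (γ - 1) :=
  mul_nonneg (angleConst_pos hγ).le
    (Real.rpow_nonneg (Real.sin_nonneg_of_nonneg_of_le_pi hφ.1.le hφ.2.le) _)

section Integrals

variable {E : Type*} [NormedAddCommGroup E] [NormedSpace ℝ E]

theorem integral_angleMeasure {γ : ℝ} (hγ : 0 < γ) (f : ℝ → E) :
    ∫ φ, f φ ∂angleMeasure γ =
      angleConst γ • ∫ φ in Ioo 0 Real.pi, Real.sin φ ^ (γ - 1) • f φ := by
  rw [angleMeasure, integral_withDensity_eq_integral_toReal_smul (by fun_prop) (by simp),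
    ← integral_smul]
  refine setIntegral_congr_fun measurableSet_Ioo fun φ hφ => ?_
  simp only [smul_smul]
  rw [ENNReal.toReal_ofReal (angleDensity_nonneg hγ hφ)]

theorem integral_radialMeasure (γ : ℝ) (f : ℝ → E) :
    ∫ r, f r ∂radialMeasure γ = ∫ r in Ioi 0, r ^ γ • f r := by
  rw [radialMeasure, integral_withDensity_eq_integral_toReal_smul (by fun_prop) (by simp)]
  refine setIntegral_congr_fun measurableSet_Ioi fun r hr => ?_
  rw [ENNReal.toReal_ofReal (Real.rpow_nonneg (le_of_lt hr) _)]

theorem integrable_radialMeasure_iff (γ : ℝ) (f : ℝ → E) :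
    Integrable f (radialMeasure γ) ↔ IntegrableOn (fun r => r ^ γ • f r) (Ioi 0) := by
  rw [radialMeasure, integrable_withDensity_iff_integrable_smul' (by fun_prop) (by simp)]
  refine integrableOn_congr_fun (fun r hr => ?_) measurableSet_Ioi
  rw [ENNReal.toReal_ofReal (Real.rpow_nonneg (le_of_lt hr) _)]

theorem ae_radialMeasure (γ : ℝ) : ∀ᵐ r ∂radialMeasure γ, 0 < r :=
  (withDensity_absolutelyContinuous _ _).ae_le (ae_restrict_mem measurableSet_Ioi)

theorem ae_angleMeasure (γ : ℝ) : ∀ᵐ φ ∂angleMeasure γ, φ ∈ Ioo 0 Real.pi :=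
  (withDensity_absolutelyContinuous _ _).ae_le (ae_restrict_mem measurableSet_Ioo)

instance (γ : ℝ) : SigmaFinite (radialMeasure γ) := by
  unfold radialMeasure
  exact SigmaFinite.withDensity_of_ne_top (by simp)

/-- Polar coordinates in the upper half-plane. -/
theorem integral_polar_halfPlane (h : ℝ × ℝ → E) :
    ∫ p in Ioi (0 : ℝ) ×ˢ Ioo 0 Real.pi, p.1 • h (p.1 * Real.cos p.2, p.1 * Real.sin p.2) =
      ∫ p in univ ×ˢ Ioi (0 : ℝ), h p := by
  rw [← integral_indicator (MeasurableSet.univ.prod measurableSet_Ioi),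
    ← integral_comp_polarCoord_symm, polarCoord_target,
    ← integral_indicator (measurableSet_Ioi.prod measurableSet_Ioo),
    ← integral_indicator (measurableSet_Ioi.prod measurableSet_Ioo)]
  congr 1
  ext p
  obtain ⟨r, φ⟩ := p
  by_cases hr : 0 < r
  · by_cases hφ : φ ∈ Ioo (-Real.pi) Real.pi
    · rw [indicator_of_mem (s := Ioi (0 : ℝ) ×ˢ Ioo (-Real.pi) Real.pi) (by exact ⟨hr, hφ⟩)]
      by_cases h0 : 0 < φ
      · rw [indicator_of_mem (by exact ⟨hr, h0, hφ.2⟩), indicator_of_mem]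
        · rfl
        · exact ⟨trivial, mul_pos hr (Real.sin_pos_of_pos_of_lt_pi h0 hφ.2)⟩
      · rw [indicator_of_notMem (by rintro ⟨-, h, -⟩; exact h0 h), indicator_of_notMem, smul_zero]
        rintro ⟨-, h⟩
        have h1 : 0 < r * Real.sin φ := h
        have := Real.sin_nonpos_of_nonpos_of_neg_pi_le (not_lt.1 h0) hφ.1.le
        nlinarith
    · rw [indicator_of_notMem (by rintro ⟨-, h, h'⟩; exact hφ ⟨by linarith [Real.pi_pos], h'⟩),
        indicator_of_notMem (by rintro ⟨-, h⟩; exact hφ h)]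
  · rw [indicator_of_notMem (by rintro ⟨h, -⟩; exact hr h),
      indicator_of_notMem (by rintro ⟨h, -⟩; exact hr h)]

end Integrals

theorem integral_rpow_mul_exp_neg_sq {q b : ℝ} (hq : -1 < q) (hb : 0 < b) :
    ∫ x in Ioi (0 : ℝ), x ^ q * Real.exp (-b * x ^ 2) =
      Real.Gamma ((q + 1) / 2) / (2 * b ^ ((q + 1) / 2)) := by
  have := integral_rpow_mul_exp_neg_mul_rpow (p := 2) two_pos hq hb
  simp only [Real.rpow_two] at this
  rw [this, neg_div, Real.rpow_neg hb.le]
  field_simp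

theorem integrable_rpow_mul_exp_neg_sq {q b : ℝ} (hq : -1 < q) (hb : 0 < b) :
    IntegrableOn (fun x : ℝ => x ^ q * Real.exp (-b * x ^ 2)) (Ioi 0) := by
  -- A non-integrable function has Bochner integral `0` by convention, so the positive value just
  -- computed certifies integrability.
  apply Integrable.of_integral_ne_zero
  rw [integral_rpow_mul_exp_neg_sq hq hb]
  have := Real.Gamma_pos_of_pos (show 0 < (q + 1) / 2 by linarith)
  positivity

theorem Gamma_nat_add_half_eq (k : ℕ) :
    Real.Gamma (k + 1 / 2) = (2 * k).factorial * √Real.pi / (4 ^ k * k.factorial) := by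
  induction k with
  | zero => simp [Real.Gamma_one_half_eq, -one_div]
  | succ k ih =>
    have : ((k + 1 : ℕ) : ℝ) + 1 / 2 = (k + 1 / 2) + 1 := by push_cast; ring
    rw [this, Real.Gamma_add_one (by positivity), ih, show 2 * (k + 1) = 2 * k + 1 + 1 by ring,
      Nat.factorial_succ, Nat.factorial_succ, Nat.factorial_succ]
    push_cast
    field_simp
    ring

theorem integral_pow_mul_exp_neg_sq (k : ℕ) :
    ∫ x : ℝ, x ^ (2 * k) * Real.exp (-1 * x ^ 2) = Real.Gamma (k + 1 / 2) := by
  have h := integral_comp_abs (f := fun x : ℝ => x ^ (2 * k) * Real.exp (-1 * x ^ 2))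
  simp only [pow_mul, sq_abs] at h ⊢
  rw [h]
  have h2 := integral_rpow_mul_exp_neg_sq (q := (2 * k : ℕ)) (b := 1)
    (by have : (0 : ℝ) ≤ (2 * k : ℕ) := Nat.cast_nonneg _
        linarith) one_pos
  simp only [Real.rpow_natCast, pow_mul, Real.one_rpow] at h2
  rw [h2]
  push_cast
  rw [show (2 * (k : ℝ) + 1) / 2 = k + 1 / 2 by ring]
  ring

/-- The classical evaluation of a beta integral: integrate `u^(2k) v^(γ-1) exp(-u² - v²)` over the
upper half-plane. Cartesian coordinates give two gamma factors; polar coordinates give a third gamma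
factor times the wanted angular integral. -/
theorem integral_cos_pow_mul_sin {γ : ℝ} (hγ : 0 < γ) (k : ℕ) :
    ∫ φ in Ioo 0 Real.pi, Real.sin φ ^ (γ - 1) * Real.cos φ ^ (2 * k) =
      Real.Gamma (k + 1 / 2) * Real.Gamma (γ / 2) / Real.Gamma (k + (γ + 1) / 2) := by
  have h := integral_polar_halfPlane (E := ℝ)
    (fun p => (p.1 ^ (2 * k) * Real.exp (-1 * p.1 ^ 2)) * (p.2 ^ (γ - 1) * Real.exp (-1 * p.2 ^ 2)))
  have e1 : EqOn (fun p : ℝ × ℝ => p.1 • (((p.1 * Real.cos p.2) ^ (2 * k) *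
      Real.exp (-1 * (p.1 * Real.cos p.2) ^ 2)) * ((p.1 * Real.sin p.2) ^ (γ - 1) *
      Real.exp (-1 * (p.1 * Real.sin p.2) ^ 2))))
      (fun p => (p.1 ^ (2 * k + γ) * Real.exp (-1 * p.1 ^ 2)) *
        (Real.sin p.2 ^ (γ - 1) * Real.cos p.2 ^ (2 * k))) (Ioi (0 : ℝ) ×ˢ Ioo 0 Real.pi) := by
    rintro ⟨r, φ⟩ ⟨hr, hφ⟩
    simp only [mem_Ioi] at hr
    have hs := Real.sin_nonneg_of_nonneg_of_le_pi hφ.1.le hφ.2.le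
    have e2 : Real.exp (-1 * r ^ 2) = Real.exp (-1 * (r * Real.cos φ) ^ 2) *
        Real.exp (-1 * (r * Real.sin φ) ^ 2) := by
      rw [← Real.exp_add]
      congr 1
      linear_combination r ^ 2 * Real.sin_sq_add_cos_sq φ
    have e3 : r ^ (2 * k + γ) = r * r ^ (2 * k) * r ^ (γ - 1) := by
      rw [show (2 * (k : ℝ) + γ) = 1 + ((2 * k : ℕ) : ℝ) + (γ - 1) by push_cast; ring,
        Real.rpow_add hr, Real.rpow_add hr, Real.rpow_one, Real.rpow_natCast]
    simp only [smul_eq_mul]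
    rw [e2, e3, Real.mul_rpow (le_of_lt hr) hs, mul_pow]
    ring
  rw [setIntegral_congr_fun (measurableSet_Ioi.prod measurableSet_Ioo) e1, Measure.volume_eq_prod,
    setIntegral_prod_mul (fun r : ℝ => r ^ (2 * (k : ℝ) + γ) * Real.exp (-1 * r ^ 2))
      (fun φ : ℝ => Real.sin φ ^ (γ - 1) * Real.cos φ ^ (2 * k)),
    setIntegral_prod_mul (fun u : ℝ => u ^ (2 * k) * Real.exp (-1 * u ^ 2))
      (fun v : ℝ => v ^ (γ - 1) * Real.exp (-1 * v ^ 2)), setIntegral_univ, integral_pow_mul_exp_neg_sq,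
    integral_rpow_mul_exp_neg_sq (by linarith) one_pos, integral_rpow_mul_exp_neg_sq
      (by have : (0 : ℝ) ≤ k := Nat.cast_nonneg _
          linarith) one_pos] at h
  have := Real.Gamma_pos_of_pos (show 0 < k + (γ + 1) / 2 by positivity)
  simp only [Real.one_rpow, sub_add_cancel, mul_one] at h
  rw [show (2 * (k : ℝ) + γ + 1) / 2 = k + (γ + 1) / 2 by ring] at h
  rw [eq_div_iff this.ne']
  linarith

theorem integrableOn_sin_rpow {γ : ℝ} (hγ : 0 < γ) :
    IntegrableOn (fun φ => Real.sin φ ^ (γ - 1)) (Ioo 0 Real.pi) := by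
  apply Integrable.of_integral_ne_zero
  have h := integral_cos_pow_mul_sin hγ 0
  simp only [mul_zero, pow_zero, mul_one] at h
  rw [h]
  have := Real.Gamma_pos_of_pos (show 0 < ((0 : ℕ) : ℝ) + (γ + 1) / 2 by positivity)
  have := Real.Gamma_pos_of_pos (show 0 < γ / 2 by positivity)
  have := Real.Gamma_pos_of_pos (show 0 < ((0 : ℕ) : ℝ) + 1 / 2 by positivity)
  positivity

theorem isProbabilityMeasure_angleMeasure {γ : ℝ} (hγ : 0 < γ) :
    IsProbabilityMeasure (angleMeasure γ) := by
  refine ⟨?_⟩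
  rw [angleMeasure, withDensity_apply _ MeasurableSet.univ, setLIntegral_univ,
    ← ofReal_integral_eq_lintegral_ofReal]
  · rw [integral_const_mul]
    have h := integral_cos_pow_mul_sin hγ 0
    simp only [mul_zero, pow_zero, mul_one, Nat.cast_zero, zero_add, Real.Gamma_one_half_eq] at h
    rw [h, angleConst]
    have := Real.Gamma_pos_of_pos (show 0 < (γ + 1) / 2 by positivity)
    have := Real.Gamma_pos_of_pos (show 0 < γ / 2 by positivity)
    rw [show Real.Gamma ((γ + 1) / 2) / (√Real.pi * Real.Gamma (γ / 2)) *
      (√Real.pi * Real.Gamma (γ / 2) / Real.Gamma ((γ + 1) / 2)) = 1 by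
        have := Real.pi_pos
        field_simp]
    simp
  · exact (integrableOn_sin_rpow hγ).const_mul _
  · filter_upwards [ae_restrict_mem measurableSet_Ioo] with φ hφ using angleDensity_nonneg hγ hφ

/-! ### Power series and Poisson integral of the normalized Bessel function. -/

/-- The coefficients of the normalized Bessel function of index `(γ - 1) / 2`. -/
def besselCoeff (γ : ℝ) (k : ℕ) : ℝ :=
  Real.Gamma ((γ + 1) / 2) / (4 ^ k * k.factorial * Real.Gamma (k + (γ + 1) / 2))

/-- The link between angles and Bessel functions: up to `(2k)!`, the series coefficients are moments
of the cosine. Both the Poisson integral and the product formula use it. -/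
theorem integral_cos_pow_even {γ : ℝ} (hγ : 0 < γ) (k : ℕ) :
    ∫ φ, Real.cos φ ^ (2 * k) ∂angleMeasure γ = (2 * k).factorial * besselCoeff γ k := by
  simp only [integral_angleMeasure hγ, smul_eq_mul]
  rw [integral_cos_pow_mul_sin hγ, Gamma_nat_add_half_eq, angleConst, besselCoeff]
  have := Real.Gamma_pos_of_pos (show 0 < γ / 2 by positivity)
  have := Real.Gamma_pos_of_pos (show 0 < k + (γ + 1) / 2 by positivity)
  have := Real.pi_pos
  field_simp

/-- The reflection `φ ↦ π - φ` preserves the weight and changes the sign of the cosine. -/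
theorem integral_cos_pow_odd {γ : ℝ} (hγ : 0 < γ) {m : ℕ} (hm : Odd m) :
    ∫ φ, Real.cos φ ^ m ∂angleMeasure γ = 0 := by
  rw [integral_angleMeasure hγ]
  have h : ∫ φ in Ioo 0 Real.pi, Real.sin φ ^ (γ - 1) • Real.cos φ ^ m =
      -∫ φ in Ioo 0 Real.pi, Real.sin φ ^ (γ - 1) • Real.cos φ ^ m := by
    conv_lhs => rw [← integral_Ioc_eq_integral_Ioo, ← intervalIntegral.integral_of_le Real.pi_pos.le]
    have := intervalIntegral.integral_comp_sub_left (a := 0) (b := Real.pi)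
      (fun φ => Real.sin φ ^ (γ - 1) • Real.cos φ ^ m) Real.pi
    rw [sub_self, sub_zero] at this
    rw [← this, intervalIntegral.integral_of_le Real.pi_pos.le, integral_Ioc_eq_integral_Ioo, ← integral_neg]
    refine setIntegral_congr_fun measurableSet_Ioo fun φ _ => ?_
    simp only [Real.sin_pi_sub, Real.cos_pi_sub, smul_eq_mul]
    rw [hm.neg_pow]
    ring
  have h0 : ∫ φ in Ioo 0 Real.pi, Real.sin φ ^ (γ - 1) • Real.cos φ ^ m = 0 := by linarith
  rw [h0, smul_zero]

theorem besselCoeff_pos {γ : ℝ} (hγ : 0 < γ) (k : ℕ) : 0 < besselCoeff γ k := by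
  have := Real.Gamma_pos_of_pos (show 0 < (γ + 1) / 2 by positivity)
  have := Real.Gamma_pos_of_pos (show 0 < k + (γ + 1) / 2 by positivity)
  unfold besselCoeff
  positivity

/-- A moment of the cosine under a probability measure is at most one. The bound makes the series of
`cosh` a majorant of the Bessel series. -/
theorem besselCoeff_le {γ : ℝ} (hγ : 0 < γ) (k : ℕ) :
    besselCoeff γ k ≤ 1 / (2 * k).factorial := by
  have := isProbabilityMeasure_angleMeasure hγ
  rw [le_div_iff₀ (by positivity), mul_comm, ← integral_cos_pow_even hγ]
  calc ∫ φ, Real.cos φ ^ (2 * k) ∂angleMeasure γ ≤ ∫ φ, (1 : ℝ) ∂angleMeasure γ := by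
        refine integral_mono_of_nonneg (ae_of_all _ fun φ => ?_) (integrable_const _)
          (ae_of_all _ fun φ => ?_)
        · simp only [pow_mul, Pi.zero_apply]; positivity
        · simp only [pow_mul]
          exact pow_le_one₀ (sq_nonneg _) (Real.cos_sq_le_one φ)
    _ = 1 := by simp

theorem summable_besselCoeff {γ : ℝ} (hγ : 0 < γ) (t : ℝ) :
    Summable fun k => ‖(-1) ^ k * besselCoeff γ k * t ^ (2 * k)‖ := by
  have h := (Real.hasSum_cosh t).summable
  refine Summable.of_nonneg_of_le (fun _ => norm_nonneg _) (fun k => ?_) h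
  rw [norm_mul, norm_mul, norm_pow, norm_neg, norm_one, one_pow, one_mul, pow_mul,
    Real.norm_of_nonneg (besselCoeff_pos hγ k).le, Real.norm_of_nonneg (by positivity),
    div_eq_mul_one_div, mul_comm]
  gcongr
  exact besselCoeff_le hγ k

theorem smallBessel_eq_tsum (γ t : ℝ) :
    smallBessel ((γ - 1) / 2) t = ∑' k : ℕ, (-1) ^ k * besselCoeff γ k * t ^ (2 * k) := by
  rw [smallBessel, ← tsum_mul_left]
  refine tsum_congr fun k => ?_
  rw [besselCoeff, show (γ - 1) / 2 + 1 = (γ + 1) / 2 by ring,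
    show (k : ℝ) + (γ - 1) / 2 + 1 = k + (γ + 1) / 2 by ring, div_pow, pow_mul 2,
    show (2 : ℝ) ^ 2 = 4 by norm_num]
  simp only [div_eq_mul_inv, mul_inv]
  ring

theorem hasSum_smallBessel {γ : ℝ} (hγ : 0 < γ) (t : ℝ) :
    HasSum (fun k : ℕ => (-1) ^ k * besselCoeff γ k * t ^ (2 * k))
      (smallBessel ((γ - 1) / 2) t) := by
  rw [smallBessel_eq_tsum]
  exact (summable_besselCoeff hγ t).of_norm.hasSum

/-- The Poisson integral. -/
theorem smallBessel_eq_integral {γ : ℝ} (hγ : 0 < γ) (t : ℝ) :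
    smallBessel ((γ - 1) / 2) t = ∫ φ, Real.cos (t * Real.cos φ) ∂angleMeasure γ := by
  have := isProbabilityMeasure_angleMeasure hγ
  have key := hasSum_integral_of_dominated_convergence (μ := angleMeasure γ)
    (F := fun (k : ℕ) φ => (-1) ^ k * (t * Real.cos φ) ^ (2 * k) / (2 * k).factorial)
    (f := fun φ => Real.cos (t * Real.cos φ))
    (fun k _ => t ^ (2 * k) / (2 * k).factorial) (fun k => by fun_prop)
    (fun k => ae_of_all _ fun φ => ?_) (ae_of_all _ fun φ => (Real.hasSum_cosh t).summable)
    (integrable_const _) (ae_of_all _ fun φ => Real.hasSum_cos _)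
  · refine (hasSum_smallBessel hγ t).unique ?_
    convert! key using 1
    ext k
    simp only [mul_pow]
    have : ∀ φ : ℝ, (-1 : ℝ) ^ k * (t ^ (2 * k) * Real.cos φ ^ (2 * k)) / (2 * k).factorial =
      ((-1) ^ k * t ^ (2 * k) / (2 * k).factorial) * Real.cos φ ^ (2 * k) := fun φ => by ring
    simp only [this]
    rw [integral_const_mul, integral_cos_pow_even hγ]
    field_simp
  · rw [norm_div, norm_mul, norm_pow, norm_neg, norm_one, one_pow, one_mul, RCLike.norm_natCast,
      mul_pow, norm_mul, pow_mul, Real.norm_of_nonneg (by positivity), pow_mul,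
      Real.norm_of_nonneg (by positivity)]
    gcongr
    exact mul_le_of_le_one_right (by positivity)
      (pow_le_one₀ (sq_nonneg _) (Real.cos_sq_le_one φ))

theorem abs_smallBessel_le {γ : ℝ} (hγ : 0 < γ) (t : ℝ) : |smallBessel ((γ - 1) / 2) t| ≤ 1 := by
  have := isProbabilityMeasure_angleMeasure hγ
  rw [smallBessel_eq_integral hγ, ← Real.norm_eq_abs]
  refine (norm_integral_le_of_norm_le_const (C := 1) (ae_of_all _ fun φ => ?_)).trans (by simp)
  exact Real.abs_cos_le_one _

theorem continuous_smallBessel {γ : ℝ} (hγ : 0 < γ) :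
    Continuous (smallBessel ((γ - 1) / 2)) := by
  have := isProbabilityMeasure_angleMeasure hγ
  simp only [funext fun t => smallBessel_eq_integral hγ t]
  refine continuous_of_dominated (bound := fun _ => 1) (fun t => by fun_prop)
    (fun t => ae_of_all _ fun φ => Real.abs_cos_le_one _) (integrable_const _)
    (ae_of_all _ fun φ => by fun_prop)

theorem smallBessel_zero {γ : ℝ} (hγ : 0 < γ) : smallBessel ((γ - 1) / 2) 0 = 1 := by
  have := isProbabilityMeasure_angleMeasure hγ
  simp [smallBessel_eq_integral hγ]


/-! ### The product formula -/

/-- A Chu–Vandermonde sum with a real parameter. Pascal's rule splits the sum for `i + 1` into the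
sum for `i` with the same `j`, `s` and, after extracting a factor `j`, the sum for `i` with `j - 1`,
`s + 1`; hence the induction generalizes over `j` and `s`. -/
theorem sum_choose_mul_descFactorial_div_Gamma (i j : ℕ) {s : ℝ} (hs : 0 < s) :
    ∑ p ∈ Finset.range (i + 1), (i.choose p * j.descFactorial p : ℝ) / Real.Gamma (p + s) =
      Real.Gamma (i + j + s) / (Real.Gamma (i + s) * Real.Gamma (j + s)) := by
  induction i generalizing j s with
  | zero =>
    have h1 := Real.Gamma_pos_of_pos hs
    have h2 := Real.Gamma_pos_of_pos (show 0 < j + s by positivity)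
    simp
    field_simp
  | succ i ih =>
    have h3 : Real.Gamma ((i + 1 : ℕ) + s) = (i + s) * Real.Gamma (i + s) := by
      rw [← Real.Gamma_add_one (by positivity)]
      congr 1
      push_cast
      ring
    have h4 : Real.Gamma ((i + 1 : ℕ) + j + s) = (i + j + s) * Real.Gamma (i + j + s) := by
      rw [← Real.Gamma_add_one (by positivity)]
      congr 1
      push_cast
      ring
    have e1 : ∑ p ∈ Finset.range (i + 1 + 1),
        ((i + 1).choose p * j.descFactorial p : ℝ) / Real.Gamma (p + s) =
        ∑ p ∈ Finset.range (i + 1), (i.choose p * j.descFactorial p : ℝ) / Real.Gamma (p + s) +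
        ∑ p ∈ Finset.range (i + 1), (i.choose p * j.descFactorial (p + 1) : ℝ) /
          Real.Gamma (p + (s + 1)) := by
      rw [Finset.sum_range_succ' (n := i + 1), Finset.sum_range_succ' (n := i) (f := fun p =>
        (i.choose p * j.descFactorial p : ℝ) / Real.Gamma (p + s))]
      have e2 : ∀ p ∈ Finset.range (i + 1),
          ((i + 1).choose (p + 1) * j.descFactorial (p + 1) : ℝ) / Real.Gamma ((p + 1 : ℕ) + s) =
          (i.choose (p + 1) * j.descFactorial (p + 1) : ℝ) / Real.Gamma ((p + 1 : ℕ) + s) +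
          (i.choose p * j.descFactorial (p + 1) : ℝ) / Real.Gamma (p + (s + 1)) := by
        intro p _
        rw [Nat.choose_succ_succ', show ((p + 1 : ℕ) : ℝ) + s = p + (s + 1) by push_cast; ring]
        push_cast
        ring
      rw [Finset.sum_congr rfl e2, Finset.sum_add_distrib, Finset.sum_range_succ (n := i)
        (f := fun p => (i.choose (p + 1) * j.descFactorial (p + 1) : ℝ) /
          Real.Gamma ((p + 1 : ℕ) + s))]
      simp
      ring
    have e3 : ∑ p ∈ Finset.range (i + 1), (i.choose p * j.descFactorial (p + 1) : ℝ) /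
          Real.Gamma (p + (s + 1)) =
        j * (Real.Gamma (i + j + s) / (Real.Gamma ((i + 1 : ℕ) + s) * Real.Gamma (j + s))) := by
      cases j with
      | zero => simp
      | succ j =>
        have := ih j (s := s + 1) (by positivity)
        rw [show (i : ℝ) + j + (s + 1) = i + (j + 1 : ℕ) + s by push_cast; ring,
          show (i : ℝ) + (s + 1) = (i + 1 : ℕ) + s by push_cast; ring,
          show (j : ℝ) + (s + 1) = (j + 1 : ℕ) + s by push_cast; ring] at this
        rw [← this, Finset.mul_sum]
        refine Finset.sum_congr rfl fun p _ => ?_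
        rw [Nat.succ_descFactorial_succ]
        push_cast
        ring
    rw [e1, e3, ih j hs, h3, h4]
    have : 0 < (i : ℝ) + s := by positivity
    field_simp
    ring

/-- The `p`-th summand is what the terms with `2p` cosine factors contribute to the coefficient of
`x^(2i) y^(2(k-i))` when the `k`-th power of the squared chord is expanded and averaged: the integer
factors amount to `4^p k! / ((i-p)! (k-i-p)!)`. The Chu–Vandermonde sum puts the total in closed
form. -/
theorem besselCoeff_mul_div (k i : ℕ) (hi : i ≤ k) {γ : ℝ} (hγ : 0 < γ) :
    besselCoeff γ i * besselCoeff γ (k - i) / besselCoeff γ k =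
      k.choose i * ∑ p ∈ Finset.range (i + 1), i.choose p * (k - i).descFactorial p *
        (4 ^ p * p.factorial * besselCoeff γ p) := by
  obtain ⟨j, rfl⟩ := Nat.exists_eq_add_of_le hi
  have hs : 0 < (γ + 1) / 2 := by positivity
  have h := sum_choose_mul_descFactorial_div_Gamma i j hs
  have e : ∑ p ∈ Finset.range (i + 1), (i.choose p * (i + j - i).descFactorial p *
      (4 ^ p * p.factorial * besselCoeff γ p) : ℝ) = Real.Gamma ((γ + 1) / 2) *
      ∑ p ∈ Finset.range (i + 1),
        (i.choose p * j.descFactorial p : ℝ) / Real.Gamma (p + (γ + 1) / 2) := by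
    rw [Finset.mul_sum]
    refine Finset.sum_congr rfl fun p _ => ?_
    have := Real.Gamma_pos_of_pos (show 0 < p + (γ + 1) / 2 by positivity)
    rw [besselCoeff, Nat.add_sub_cancel_left]
    field_simp
  rw [e, h, Nat.add_sub_cancel_left, Nat.cast_add_choose]
  simp only [besselCoeff]
  push_cast
  rw [pow_add]
  field_simp

/-- The quotient of coefficients is exactly what the product formula needs: multiplied by
`besselCoeff γ k`, the sum becomes the `k`-th term of a Cauchy product of two Bessel series. The
proof expands twice by the binomial theorem and discards odd cosine moments. -/
theorem integral_chord_pow {γ : ℝ} (hγ : 0 < γ) (x y : ℝ) (k : ℕ) :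
    ∫ φ, (x ^ 2 + y ^ 2 - 2 * x * y * Real.cos φ) ^ k ∂angleMeasure γ =
      ∑ i ∈ Finset.range (k + 1), besselCoeff γ i * besselCoeff γ (k - i) / besselCoeff γ k *
        (x ^ (2 * i) * y ^ (2 * (k - i))) := by
  have := isProbabilityMeasure_angleMeasure hγ
  have e1 : ∀ φ, (x ^ 2 + y ^ 2 - 2 * x * y * Real.cos φ) ^ k =
      ∑ m ∈ Finset.range (k + 1), (-(2 * x * y)) ^ m * (x ^ 2 + y ^ 2) ^ (k - m) * k.choose m *
        Real.cos φ ^ m := by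
    intro φ
    rw [show x ^ 2 + y ^ 2 - 2 * x * y * Real.cos φ =
      -(2 * x * y) * Real.cos φ + (x ^ 2 + y ^ 2) by ring, add_pow]
    refine Finset.sum_congr rfl fun m _ => ?_
    rw [mul_pow]
    ring
  have hint : ∀ m : ℕ, Integrable (fun φ => Real.cos φ ^ m) (angleMeasure γ) := by
    intro m
    refine (integrable_const (1 : ℝ)).mono' (by fun_prop) (ae_of_all _ fun φ => ?_)
    rw [norm_pow]
    exact pow_le_one₀ (norm_nonneg _) (Real.abs_cos_le_one φ)
  have heven : ∀ p : ℕ, (-(2 * x * y)) ^ (2 * p) = 4 ^ p * x ^ (2 * p) * y ^ (2 * p) := by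
    intro p
    rw [pow_mul, pow_mul, pow_mul, ← mul_pow, ← mul_pow]
    ring
  simp only [e1]
  rw [integral_finsetSum _ fun m _ => (hint m).const_mul _]
  have e2 : ∀ m ∈ Finset.range (k + 1),
      ∫ φ, (-(2 * x * y)) ^ m * (x ^ 2 + y ^ 2) ^ (k - m) * k.choose m * Real.cos φ ^ m
        ∂angleMeasure γ = ∑ l ∈ Finset.range (k - m + 1), (-(2 * x * y)) ^ m *
          (x ^ (2 * l) * y ^ (2 * (k - m - l))) * (k.choose m * (k - m).choose l) *
          ∫ φ, Real.cos φ ^ m ∂angleMeasure γ := by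
    intro m _
    rw [integral_const_mul, add_pow]
    simp only [Finset.mul_sum, Finset.sum_mul, pow_mul]
    refine Finset.sum_congr rfl fun l _ => ?_
    ring
  have e3 : ∀ i ∈ Finset.range (k + 1),
      besselCoeff γ i * besselCoeff γ (k - i) / besselCoeff γ k *
        (x ^ (2 * i) * y ^ (2 * (k - i))) =
      ∑ p ∈ Finset.range (i + 1), (k.choose i * (i.choose p * (k - i).descFactorial p *
        (4 ^ p * p.factorial * besselCoeff γ p))) * (x ^ (2 * i) * y ^ (2 * (k - i))) := by
    intro i hi
    rw [besselCoeff_mul_div k i (Nat.lt_succ_iff.1 (Finset.mem_range.1 hi)) hγ, Finset.mul_sum,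
      Finset.sum_mul]
  rw [Finset.sum_congr rfl e2, Finset.sum_congr rfl e3, Finset.sum_sigma', Finset.sum_sigma']
  symm
  -- The pair `(i, p)` corresponds to `m = 2p` cosine factors and `l = i - p` factors `x²`. Only
  -- nonzero terms are matched, since odd `m` on one side and `p > k - i` on the other have no
  -- partner.
  refine Finset.sum_bij_ne_zero (fun a _ _ => ⟨2 * a.2, a.1 - a.2⟩) ?_ ?_ ?_ ?_
  · rintro ⟨i, p⟩ h h'
    simp only [Finset.mem_sigma, Finset.mem_range] at h ⊢
    have hp : p ≤ k - i := by
      by_contra hp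
      exact h' (by simp [Nat.descFactorial_eq_zero_iff_lt.2 (not_le.1 hp)])
    omega
  · rintro ⟨i, p⟩ h _ ⟨i', p'⟩ h2 _ h3
    simp only [Finset.mem_sigma, Finset.mem_range, Sigma.mk.injEq, heq_eq_eq] at h h2 h3 ⊢
    omega
  · rintro ⟨m, l⟩ h h'
    simp only [Finset.mem_sigma, Finset.mem_range] at h
    obtain ⟨p, rfl | rfl⟩ := Nat.even_or_odd' m
    · refine ⟨⟨l + p, p⟩, ?_, ?_, ?_⟩
      · simp only [Finset.mem_sigma, Finset.mem_range]
        omega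
      · intro h0
        apply h'
        have hb := besselCoeff_pos hγ p
        have hc := Nat.choose_pos (show l + p ≤ k by omega)
        have hc2 := Nat.choose_pos (show p ≤ l + p by omega)
        have hd : 0 < (k - (l + p)).descFactorial p := by
          rw [Nat.pos_iff_ne_zero, Ne, Nat.descFactorial_eq_zero_iff_lt]
          omega
        -- The numerical coefficient is positive, so the term can vanish only through its monomial,
        -- which happens when `x` or `y` is zero; the matching term then vanishes too.
        have h1 : x ^ (2 * (l + p)) * y ^ (2 * (k - (l + p))) = 0 := by
          refine (mul_eq_zero.1 h0).resolve_left (ne_of_gt ?_)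
          positivity
        have h2 : (-(2 * x * y)) ^ (2 * p) * (x ^ (2 * l) * y ^ (2 * (k - 2 * p - l))) =
            4 ^ p * (x ^ (2 * (l + p)) * y ^ (2 * (k - (l + p)))) := by
          rw [show k - (l + p) = k - 2 * p - l + p by omega, heven]
          ring
        simp only
        rw [h2, h1]
        simp
      · simp
    · exact absurd (by simp [integral_cos_pow_odd hγ (odd_two_mul_add_one p)]) h'
  · rintro ⟨i, p⟩ h h'
    simp only [Finset.mem_sigma, Finset.mem_range] at h ⊢
    have hp : p ≤ k - i := by
      by_contra hp
      exact h' (by simp [Nat.descFactorial_eq_zero_iff_lt.2 (not_le.1 hp)])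
    obtain ⟨l, rfl⟩ := Nat.exists_eq_add_of_le (show p ≤ i by omega)
    obtain ⟨q, rfl⟩ := Nat.exists_eq_add_of_le (show p + l + p ≤ k by omega)
    rw [integral_cos_pow_even hγ, show p + l - p = l by omega,
      show p + l + p + q - 2 * p = l + q by omega, show l + q - l = q by omega,
      show p + l + p + q - (p + l) = p + q by omega, heven]
    have c1 : ((p + l + p + q).choose (p + l) : ℝ) =
        (p + l + p + q).factorial / ((p + l).factorial * (p + q).factorial) := by
      rw [show p + l + p + q = (p + l) + (p + q) by ring]
      exact Nat.cast_add_choose ℝ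
    have c2 : ((p + l + p + q).choose (2 * p) : ℝ) =
        (p + l + p + q).factorial / ((2 * p).factorial * (l + q).factorial) := by
      rw [show p + l + p + q = 2 * p + (l + q) by ring]
      exact Nat.cast_add_choose ℝ
    have c3 : ((p + q).descFactorial p : ℝ) = (p + q).factorial / q.factorial := by
      rw [eq_div_iff (by positivity), ← Nat.factorial_mul_descFactorial (show p ≤ p + q by omega),
        Nat.add_sub_cancel_left]
      push_cast
      ring
    rw [c1, c2, c3, Nat.cast_add_choose, Nat.cast_add_choose]
    field_simp
    ring

theorem chord_nonneg (x y φ : ℝ) : 0 ≤ x ^ 2 + y ^ 2 - 2 * x * y * Real.cos φ := by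
  nlinarith [sq_nonneg (x - y * Real.cos φ), Real.sin_sq_add_cos_sq φ,
    mul_nonneg (sq_nonneg y) (sq_nonneg (Real.sin φ))]

theorem chord_le (x y φ : ℝ) :
    x ^ 2 + y ^ 2 - 2 * x * y * Real.cos φ ≤ 2 * (x ^ 2 + y ^ 2) := by
  nlinarith [sq_nonneg (x + y * Real.cos φ), Real.sin_sq_add_cos_sq φ,
    mul_nonneg (sq_nonneg y) (sq_nonneg (Real.sin φ))]

/-- The product formula: normalized Bessel functions are characters of the translation. -/
theorem integral_smallBessel_chord {γ : ℝ} (hγ : 0 < γ) (x y η : ℝ) :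
    ∫ φ, smallBessel ((γ - 1) / 2) (√(x ^ 2 + y ^ 2 - 2 * x * y * Real.cos φ) * η)
      ∂angleMeasure γ =
    smallBessel ((γ - 1) / 2) (x * η) * smallBessel ((γ - 1) / 2) (y * η) := by
  have := isProbabilityMeasure_angleMeasure hγ
  have hpow : ∀ (φ : ℝ) (k : ℕ), (√(x ^ 2 + y ^ 2 - 2 * x * y * Real.cos φ) * η) ^ (2 * k) =
      (x ^ 2 + y ^ 2 - 2 * x * y * Real.cos φ) ^ k * η ^ (2 * k) := by
    intro φ k
    rw [mul_pow, pow_mul, Real.sq_sqrt (chord_nonneg x y φ)]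
  -- The series is averaged term by term. The squared chord is at most `2(x² + y²)` for every angle,
  -- so the series at that fixed argument dominates.
  have key := hasSum_integral_of_dominated_convergence (μ := angleMeasure γ)
    (F := fun (k : ℕ) φ => (-1) ^ k * besselCoeff γ k *
      ((x ^ 2 + y ^ 2 - 2 * x * y * Real.cos φ) ^ k * η ^ (2 * k)))
    (f := fun φ => smallBessel ((γ - 1) / 2) (√(x ^ 2 + y ^ 2 - 2 * x * y * Real.cos φ) * η))
    (fun k _ => ‖(-1) ^ k * besselCoeff γ k * (√(2 * (x ^ 2 + y ^ 2)) * η) ^ (2 * k)‖)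
    (fun k => by fun_prop)
    (fun k => ae_of_all _ fun φ => ?_)
    (ae_of_all _ fun φ => summable_besselCoeff hγ _)
    (integrable_const _) (ae_of_all _ fun φ => ?_)
  · rw [← key.tsum_eq, smallBessel_eq_tsum, smallBessel_eq_tsum,
      tsum_mul_tsum_eq_tsum_sum_antidiagonal_of_summable_norm (summable_besselCoeff hγ _)
        (summable_besselCoeff hγ _)]
    refine tsum_congr fun k => ?_
    rw [integral_const_mul, integral_mul_const, integral_chord_pow hγ,
      Finset.Nat.sum_antidiagonal_eq_sum_range_succ_mk, Finset.sum_mul, Finset.mul_sum]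
    refine Finset.sum_congr rfl fun i hi => ?_
    have hb := besselCoeff_pos hγ k
    obtain ⟨j, rfl⟩ := Nat.exists_eq_add_of_le (Nat.lt_succ_iff.1 (Finset.mem_range.1 hi))
    simp only [Nat.add_sub_cancel_left]
    rw [mul_pow, mul_pow, mul_add 2, pow_add, pow_add]
    field_simp
  · rw [norm_mul ((-1) ^ k * besselCoeff γ k), norm_mul ((-1) ^ k * besselCoeff γ k)]
    refine mul_le_mul_of_nonneg_left ?_ (norm_nonneg ((-1) ^ k * besselCoeff γ k))
    rw [mul_pow, norm_mul, norm_mul, pow_mul √(2 * (x ^ 2 + y ^ 2)), Real.sq_sqrt (by positivity)]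
    refine mul_le_mul_of_nonneg_right ?_ (norm_nonneg (η ^ (2 * k)))
    rw [norm_pow, norm_pow, Real.norm_of_nonneg (chord_nonneg x y φ),
      Real.norm_of_nonneg (show 0 ≤ 2 * (x ^ 2 + y ^ 2) by positivity)]
    exact pow_le_pow_left₀ (chord_nonneg x y φ) (chord_le x y φ) k
  · have := hasSum_smallBessel hγ (√(x ^ 2 + y ^ 2 - 2 * x * y * Real.cos φ) * η)
    simpa only [hpow] using this

/-! ### Gaussian integrals of Bessel functions -/

theorem integrable_radial_exp {γ s : ℝ} (hγ : 0 < γ) (hs : 0 < s) (a : ℝ) :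
    Integrable (fun r => Real.exp (-s * r ^ 2 + a * r)) (radialMeasure γ) := by
  rw [integrable_radialMeasure_iff]
  -- Half of the Gaussian absorbs the linear term: completing the square gives `-s r² + a r ≤ -(s/2)
  -- r² + a²/(2s)`.
  have h := (integrable_rpow_mul_exp_neg_sq (q := γ) (by linarith)
    (half_pos hs)).const_mul (Real.exp (a ^ 2 / (2 * s)))
  refine h.mono' (by fun_prop) ?_
  filter_upwards [ae_restrict_mem measurableSet_Ioi] with r hr
  have hr' : 0 ≤ r ^ γ := Real.rpow_nonneg (le_of_lt hr) _
  rw [norm_smul, Real.norm_of_nonneg hr', Real.norm_of_nonneg (Real.exp_nonneg _),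
    mul_left_comm, ← Real.exp_add]
  refine mul_le_mul_of_nonneg_left (Real.exp_le_exp.2 ?_) hr'
  have : 0 ≤ (s * r - a) ^ 2 / (2 * s) := by positivity
  have e : (s * r - a) ^ 2 / (2 * s) = s / 2 * r ^ 2 - a * r + a ^ 2 / (2 * s) := by
    field_simp
    ring
  linarith

theorem norm_cexp_radial_angle_le (s : ℝ) (w : ℂ) {r : ℝ} (hr : 0 ≤ r) (φ : ℝ) :
    ‖Complex.exp (-s * r ^ 2 + w * (r * Real.cos φ : ℝ))‖ ≤
      Real.exp (-s * r ^ 2 + ‖w‖ * r) := by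
  rw [Complex.norm_exp]
  refine Real.exp_le_exp.2 ?_
  rw [Complex.add_re, Complex.re_mul_ofReal,
    show (-s * r ^ 2 : ℂ) = ((-s * r ^ 2 : ℝ) : ℂ) by push_cast; ring, Complex.ofReal_re]
  refine add_le_add le_rfl ?_
  calc w.re * (r * Real.cos φ) ≤ |w.re * (r * Real.cos φ)| := le_abs_self _
    _ = |w.re| * (r * |Real.cos φ|) := by rw [abs_mul, abs_mul, abs_of_nonneg hr]
    _ ≤ ‖w‖ * (r * 1) := by
      gcongr
      · exact Complex.abs_re_le_norm w
      · exact Real.abs_cos_le_one φ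
    _ = ‖w‖ * r := by ring

theorem integrable_radial_angle_exp {γ s : ℝ} (hγ : 0 < γ) (hs : 0 < s) (w : ℂ) :
    Integrable (fun p : ℝ × ℝ => Complex.exp (-s * p.1 ^ 2 + w * (p.1 * Real.cos p.2 : ℝ)))
      ((radialMeasure γ).prod (angleMeasure γ)) := by
  have := isProbabilityMeasure_angleMeasure hγ
  refine ((integrable_radial_exp hγ hs ‖w‖).comp_fst (angleMeasure γ)).mono' (by fun_prop) ?_
  filter_upwards [Measure.quasiMeasurePreserving_fst.ae (ae_radialMeasure γ)] with p hp
  exact norm_cexp_radial_angle_le s w (le_of_lt hp) p.2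

/-- With `u = r cos φ` and `v = r sin φ` the exponent becomes `-s(u² + v²) + w u` and the two
weights combine to `v^(γ-1) du dv`, so the integral splits into a quadratic exponential in `u` and a
gamma integral in `v`. Complex `w` serves two purposes: imaginary `w` gives Weber's first integral,
real `w` the mass of a translated Gaussian. -/
theorem integral_radial_angle_exp {γ s : ℝ} (hγ : 0 < γ) (hs : 0 < s) (w : ℂ) :
    ∫ r, ∫ φ, Complex.exp (-s * r ^ 2 + w * (r * Real.cos φ : ℝ)) ∂angleMeasure γ
      ∂radialMeasure γ =
    (Real.Gamma ((γ + 1) / 2) / (2 * s ^ ((γ + 1) / 2)) : ℝ) * Complex.exp (w ^ 2 / (4 * s)) := by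
  have hint : IntegrableOn (fun p : ℝ × ℝ => p.1 ^ γ • (Real.sin p.2 ^ (γ - 1) •
      Complex.exp (-s * p.1 ^ 2 + w * (p.1 * Real.cos p.2 : ℝ)))) (Ioi 0 ×ˢ Ioo 0 Real.pi)
      (volume.prod volume) := by
    have h1 := (integrable_radialMeasure_iff γ _).1 (integrable_radial_exp hγ hs ‖w‖)
    have h2 := integrableOn_sin_rpow hγ
    have h3 := Integrable.mul_prod h1 h2
    rw [Measure.prod_restrict] at h3
    refine h3.mono' (Measurable.aestronglyMeasurable (by fun_prop)) ?_
    filter_upwards [ae_restrict_mem (measurableSet_Ioi.prod measurableSet_Ioo)] with p hp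
    have hr := le_of_lt (show 0 < p.1 from hp.1)
    rw [norm_smul, norm_smul, Real.norm_of_nonneg (Real.rpow_nonneg hr _), Real.norm_of_nonneg
      (Real.rpow_nonneg (Real.sin_nonneg_of_nonneg_of_le_pi hp.2.1.le hp.2.2.le) _), smul_eq_mul,
      mul_comm (Real.sin p.2 ^ (γ - 1)), ← mul_assoc]
    have := Real.rpow_nonneg hr γ
    have := Real.rpow_nonneg (Real.sin_nonneg_of_nonneg_of_le_pi hp.2.1.le hp.2.2.le) (γ - 1)
    gcongr
    exact norm_cexp_radial_angle_le s w hr p.2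
  -- The added `0` is the constant coefficient in the normal form of `integral_cexp_quadratic`.
  have e1 : EqOn (fun p : ℝ × ℝ => p.1 ^ γ • (Real.sin p.2 ^ (γ - 1) •
      Complex.exp (-s * p.1 ^ 2 + w * (p.1 * Real.cos p.2 : ℝ))))
      (fun p => p.1 • (Complex.exp (-s * (p.1 * Real.cos p.2 : ℝ) ^ 2 + w *
        (p.1 * Real.cos p.2 : ℝ) + 0) * ((p.1 * Real.sin p.2) ^ (γ - 1) *
          Real.exp (-s * (p.1 * Real.sin p.2) ^ 2) : ℝ))) (Ioi 0 ×ˢ Ioo 0 Real.pi) := by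
    rintro ⟨r, φ⟩ ⟨hr, hφ⟩
    simp only [mem_Ioi] at hr
    have hs := Real.sin_nonneg_of_nonneg_of_le_pi hφ.1.le hφ.2.le
    have e3 : r ^ γ = r * r ^ (γ - 1) := by
      rw [show γ = 1 + (γ - 1) by ring, Real.rpow_add hr, Real.rpow_one]
      ring_nf
    have e4 : Complex.exp (-s * r ^ 2 + w * (r * Real.cos φ : ℝ)) =
        Complex.exp (-s * (r * Real.cos φ : ℝ) ^ 2 + w * (r * Real.cos φ : ℝ) + 0) *
          Complex.exp ((-s * (r * Real.sin φ) ^ 2 : ℝ)) := by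
      rw [← Complex.exp_add]
      congr 1
      have := congrArg (fun x : ℝ => (x : ℂ)) (Real.sin_sq_add_cos_sq φ)
      push_cast at this ⊢
      linear_combination s * r ^ 2 * this
    simp only [Complex.real_smul]
    rw [e4, e3, Real.mul_rpow hr.le hs]
    push_cast
    ring
  simp only [integral_radialMeasure, integral_angleMeasure hγ]
  simp only [smul_comm _ (angleConst γ), ← integral_smul]
  simp only [integral_smul (angleConst γ)]
  rw [← setIntegral_prod _ hint, setIntegral_congr_fun (measurableSet_Ioi.prod measurableSet_Ioo) e1,
    ← Measure.volume_eq_prod, integral_polar_halfPlane (fun p : ℝ × ℝ =>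
      Complex.exp (-s * (p.1 : ℂ) ^ 2 + w * (p.1 : ℂ) + 0) * (p.2 ^ (γ - 1) *
          Real.exp (-s * p.2 ^ 2) : ℝ)), Measure.volume_eq_prod,
    setIntegral_prod_mul (fun u : ℝ => Complex.exp (-s * (u : ℂ) ^ 2 + w * (u : ℂ) + 0))
      (fun v : ℝ => ((v ^ (γ - 1) * Real.exp (-s * v ^ 2) : ℝ) : ℂ)), setIntegral_univ,
    integral_cexp_quadratic (by simpa using hs), integral_complex_ofReal,
    integral_rpow_mul_exp_neg_sq (by linarith) hs, neg_neg, ← Complex.ofReal_div,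
    show (1 / 2 : ℂ) = ((1 / 2 : ℝ) : ℂ) by push_cast; ring,
    ← Complex.ofReal_cpow (by positivity), ← Real.sqrt_eq_rpow, Complex.real_smul]
  have e5 : (0 - w ^ 2 / (4 * -s) : ℂ) = w ^ 2 / (4 * s) := by
    rw [mul_neg, div_neg, zero_sub, neg_neg]
  have e6 : angleConst γ * (√(Real.pi / s) * (Real.Gamma ((γ - 1 + 1) / 2) /
      (2 * s ^ ((γ - 1 + 1) / 2)))) = Real.Gamma ((γ + 1) / 2) / (2 * s ^ ((γ + 1) / 2)) := by
    have := Real.Gamma_pos_of_pos (show 0 < γ / 2 by positivity)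
    have := Real.pi_pos
    rw [angleConst, sub_add_cancel, Real.sqrt_div Real.pi_pos.le, add_div, Real.rpow_add hs,
      ← Real.sqrt_eq_rpow]
    field_simp
  rw [e5, ← e6]
  push_cast
  ring

/-- Weber's first exponential integral. -/
theorem integral_smallBessel_gaussian {γ s : ℝ} (hγ : 0 < γ) (hs : 0 < s) (η : ℝ) :
    ∫ r, smallBessel ((γ - 1) / 2) (r * η) * Real.exp (-s * r ^ 2) ∂radialMeasure γ =
      Real.Gamma ((γ + 1) / 2) / (2 * s ^ ((γ + 1) / 2)) * Real.exp (-η ^ 2 / (4 * s)) := by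
  have := isProbabilityMeasure_angleMeasure hγ
  have hI := integrable_radial_angle_exp hγ hs (Complex.I * η)
  have h := congrArg Complex.re (integral_radial_angle_exp hγ hs (Complex.I * η))
  have e1 : Complex.exp ((Complex.I * η) ^ 2 / (4 * s)) = ((Real.exp (-η ^ 2 / (4 * s)) : ℝ) : ℂ) := by
    rw [mul_pow, Complex.I_sq]
    push_cast
    ring_nf
  rw [e1, ← Complex.ofReal_mul, Complex.ofReal_re, ← integral_prod _ hI,
    ← Complex.reCLM_apply, ← Complex.reCLM.integral_comp_comm hI,
    integral_prod _ (Complex.reCLM.integrable_comp hI)] at h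
  rw [← h]
  refine integral_congr_ae (ae_of_all _ fun r => ?_)
  simp only
  rw [smallBessel_eq_integral hγ, ← integral_mul_const]
  refine integral_congr_ae (ae_of_all _ fun φ => ?_)
  simp only [Complex.reCLM_apply]
  rw [Complex.exp_re]
  have : (-s * r ^ 2 + Complex.I * η * (r * Real.cos φ : ℝ) : ℂ) =
      ((-s * r ^ 2 : ℝ) : ℂ) + ((r * η * Real.cos φ : ℝ) : ℂ) * Complex.I := by
    push_cast
    ring
  rw [this]
  simp only [Complex.add_re, Complex.add_im, Complex.ofReal_re, Complex.ofReal_im,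
    Complex.re_ofReal_mul, Complex.im_ofReal_mul, Complex.I_re, Complex.I_im]
  ring_nf

/-- The generalized translation of the Gaussian `exp (-b z ^ 2)`. -/
def translatedGaussian (γ b y z : ℝ) : ℝ :=
  ∫ φ, Real.exp (-b * (y ^ 2 + z ^ 2 - 2 * y * z * Real.cos φ)) ∂angleMeasure γ

theorem translatedGaussian_nonneg (γ b y z : ℝ) : 0 ≤ translatedGaussian γ b y z :=
  integral_nonneg fun _ => (Real.exp_pos _).le

theorem translatedGaussian_le {γ b y z : ℝ} (hγ : 0 < γ) (hb : 0 < b) (hyz : 0 ≤ y * z) :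
    translatedGaussian γ b y z ≤ Real.exp (-b * (z - y) ^ 2) := by
  have := isProbabilityMeasure_angleMeasure hγ
  calc translatedGaussian γ b y z ≤ ∫ φ, Real.exp (-b * (z - y) ^ 2) ∂angleMeasure γ := by
        refine integral_mono_of_nonneg (ae_of_all _ fun φ => (Real.exp_pos _).le)
          (integrable_const _) (ae_of_all _ fun φ => ?_)
        simp only
        rw [Real.exp_le_exp, neg_mul, neg_mul, neg_le_neg_iff]
        gcongr
        nlinarith [Real.cos_le_one φ]
    _ = _ := by simp

theorem continuous_translatedGaussian {γ b : ℝ} (hγ : 0 < γ) (hb : 0 < b) (y : ℝ) :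
    Continuous (translatedGaussian γ b y) := by
  have := isProbabilityMeasure_angleMeasure hγ
  refine continuous_of_dominated (bound := fun _ => 1) (fun t => by fun_prop)
    (fun t => ae_of_all _ fun φ => ?_) (integrable_const _) (ae_of_all _ fun φ => by fun_prop)
  rw [Real.norm_of_nonneg (Real.exp_pos _).le, Real.exp_le_one_iff, neg_mul, neg_nonpos]
  exact mul_nonneg hb.le (chord_nonneg _ _ _)

/-- Translation preserves mass: after multiplication by `exp(b y²)` this is the preceding half-plane
integral at `w = 2 b y`, and the exponential factors cancel. -/
theorem integral_translatedGaussian {γ b : ℝ} (hγ : 0 < γ) (hb : 0 < b) (y : ℝ) :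
    ∫ z, translatedGaussian γ b y z ∂radialMeasure γ =
      Real.Gamma ((γ + 1) / 2) / (2 * b ^ ((γ + 1) / 2)) := by
  have h := integral_radial_angle_exp hγ hb ((2 * b * y : ℝ) : ℂ)
  have e : ∀ z φ, Complex.exp (-b * z ^ 2 + (2 * b * y : ℝ) * (z * Real.cos φ : ℝ)) =
      ((Real.exp (b * y ^ 2) * Real.exp (-b * (y ^ 2 + z ^ 2 - 2 * y * z * Real.cos φ)) : ℝ) : ℂ)
      := by
    intro z φ
    rw [← Real.exp_add, Complex.ofReal_exp]
    congr 1
    push_cast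
    ring
  simp only [e, integral_complex_ofReal, integral_const_mul] at h
  rw [← Complex.ofReal_pow, show (4 * b : ℂ) = ((4 * b : ℝ) : ℂ) by push_cast; ring,
    ← Complex.ofReal_div, ← Complex.ofReal_exp, ← Complex.ofReal_mul, Complex.ofReal_inj,
    show (2 * b * y) ^ 2 / (4 * b) = b * y ^ 2 by field_simp; ring, mul_comm] at h
  exact mul_right_cancel₀ (Real.exp_pos _).ne' h

/-- Weber's second exponential integral. -/
theorem integral_smallBessel_mul_gaussian {γ s : ℝ} (hγ : 0 < γ) (hs : 0 < s) (y z : ℝ) :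
    ∫ r, smallBessel ((γ - 1) / 2) (r * y) * smallBessel ((γ - 1) / 2) (r * z) *
        Real.exp (-s * r ^ 2) ∂radialMeasure γ =
      Real.Gamma ((γ + 1) / 2) / (2 * s ^ ((γ + 1) / 2)) *
        translatedGaussian γ (1 / (4 * s)) y z := by
  have := isProbabilityMeasure_angleMeasure hγ
  have hI : Integrable (fun p : ℝ × ℝ => smallBessel ((γ - 1) / 2)
      (p.1 * √(y ^ 2 + z ^ 2 - 2 * y * z * Real.cos p.2)) * Real.exp (-s * p.1 ^ 2))
      ((radialMeasure γ).prod (angleMeasure γ)) := by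
    have hc := continuous_smallBessel hγ
    refine ((integrable_radial_exp hγ hs 0).comp_fst (angleMeasure γ)).mono' (by fun_prop) ?_
    refine ae_of_all _ fun p => ?_
    rw [norm_mul, Real.norm_of_nonneg (Real.exp_pos _).le, zero_mul, add_zero]
    exact mul_le_of_le_one_left (Real.exp_pos _).le (abs_smallBessel_le hγ _)
  -- The product formula merges the two Bessel factors into an average of one, so that Fubini
  -- reduces the claim to the first Weber integral at each chord.
  have e : ∀ r, smallBessel ((γ - 1) / 2) (r * y) * smallBessel ((γ - 1) / 2) (r * z) *
      Real.exp (-s * r ^ 2) = ∫ φ, smallBessel ((γ - 1) / 2)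
      (r * √(y ^ 2 + z ^ 2 - 2 * y * z * Real.cos φ)) * Real.exp (-s * r ^ 2) ∂angleMeasure γ := by
    intro r
    rw [integral_mul_const, mul_comm r y, mul_comm r z, ← integral_smallBessel_chord hγ]
    simp only [mul_comm r]
  simp only [e]
  rw [integral_integral_swap hI]
  simp only [integral_smallBessel_gaussian hγ hs]
  rw [integral_const_mul, translatedGaussian]
  congr 2
  ext φ
  rw [Real.sq_sqrt (chord_nonneg _ _ _)]
  ring_nf

/-! ### Uniqueness of finite measures with given Gaussian integrals -/

open scoped BoundedContinuousFunction NNReal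

/-- The function `u ↦ exp (-∑ t_i u_i ^ 2)` on the closed orthant. -/
def gaussianTest {ι : Type*} [Fintype ι] (t : ι → ℝ) (ht : ∀ i, 0 < t i) : (ι → ℝ≥0) →ᵇ ℝ :=
  BoundedContinuousFunction.ofNormedAddCommGroup
    (fun u => Real.exp (-∑ i, t i * (u i : ℝ) ^ 2)) (by fun_prop) 1 fun u => by
      rw [Real.norm_of_nonneg (Real.exp_pos _).le, Real.exp_le_one_iff, neg_nonpos]
      exact Finset.sum_nonneg fun i _ => mul_nonneg (ht i).le (sq_nonneg _)

theorem gaussianTest_apply {ι : Type*} [Fintype ι] (t : ι → ℝ) (ht : ∀ i, 0 < t i)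
    (u : ι → ℝ≥0) : gaussianTest t ht u = Real.exp (-∑ i, t i * (u i : ℝ) ^ 2) := rfl

/-- Exponents add, so Gaussians are closed under products and the algebra they generate is the
linear span of `1` and the Gaussians. Equality of integrals then has to be checked only on these. -/
theorem gaussianTest_mem_closure {ι : Type*} [Fintype ι] {f : (ι → ℝ≥0) →ᵇ ℝ}
    (hf : f ∈ Submonoid.closure {g | ∃ t : ι → ℝ, ∃ ht, g = gaussianTest t ht}) :
    f = 1 ∨ ∃ t : ι → ℝ, ∃ ht, f = gaussianTest t ht := by
  induction hf using Submonoid.closure_induction with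
  | mem g hg => exact Or.inr hg
  | one => exact Or.inl rfl
  | mul g g' _ _ h h' =>
    obtain rfl | ⟨t, ht, rfl⟩ := h
    · simpa using h'
    · obtain rfl | ⟨t', ht', rfl⟩ := h'
      · exact Or.inr ⟨t, ht, by simp⟩
      · refine Or.inr ⟨t + t', fun i => add_pos (ht i) (ht' i), ?_⟩
        ext u
        simp only [BoundedContinuousFunction.mul_apply, gaussianTest_apply, Pi.add_apply]
        rw [← Real.exp_add, ← neg_add, ← Finset.sum_add_distrib]
        simp only [add_mul]

/-- A point-separating star subalgebra of bounded continuous functions determines finite measures on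
a complete separable metric space. Nonnegative coordinates are essential for separation, as only
squares enter; the total mass is a separate hypothesis because all `t i` are positive. -/
theorem ext_of_integral_gaussianTest {ι : Type*} [Fintype ι] {μ ν : Measure (ι → ℝ≥0)}
    [IsFiniteMeasure μ] [IsFiniteMeasure ν] (h0 : μ.real univ = ν.real univ)
    (h : ∀ t : ι → ℝ, (∀ i, 0 < t i) → ∫ u, Real.exp (-∑ i, t i * (u i : ℝ) ^ 2) ∂μ =
      ∫ u, Real.exp (-∑ i, t i * (u i : ℝ) ^ 2) ∂ν) : μ = ν := by
  classical
  let A : StarSubalgebra ℝ ((ι → ℝ≥0) →ᵇ ℝ) :=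
    { Algebra.adjoin ℝ {g | ∃ t : ι → ℝ, ∃ ht, g = gaussianTest t ht} with
      star_mem' := fun {a} ha => by
        have : star a = a := by
          ext u
          simp
        rwa [this] }
  have hA : ∀ t ht, gaussianTest t ht ∈ A := fun t ht => by
    change gaussianTest t ht ∈ Algebra.adjoin ℝ {g | ∃ t : ι → ℝ, ∃ ht, g = gaussianTest t ht}
    exact Algebra.subset_adjoin ⟨t, ht, rfl⟩
  refine ext_of_forall_mem_subalgebra_integral_eq_of_pseudoEMetric_complete_countable (𝕜 := ℝ)
    (A := A) ?_ ?_
  · intro u v huv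
    obtain ⟨i, hi⟩ := Function.ne_iff.1 huv
    by_contra hcon
    have key : ∀ t : ι → ℝ, (∀ i, 0 < t i) → ∑ i, t i * (u i : ℝ) ^ 2 = ∑ i, t i * (v i : ℝ) ^ 2 := by
      intro t ht
      by_contra hne
      apply hcon
      refine ⟨_, ⟨_, ⟨gaussianTest t ht, hA t ht, rfl⟩, rfl⟩, ?_⟩
      change gaussianTest t ht u ≠ gaussianTest t ht v
      rw [gaussianTest_apply, gaussianTest_apply, Ne, Real.exp_eq_exp, neg_inj]
      exact hne
    -- Raising a single weight from `1` to `2` isolates the square of the coordinate where the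
    -- points differ.
    have k1 := key (fun _ => 1) (fun _ => one_pos)
    have k2 := key (fun j => 1 + if j = i then 1 else 0) (fun j => by positivity)
    simp only [one_mul] at k1
    simp only [add_mul, Finset.sum_add_distrib, k1, ite_mul, one_mul, zero_mul, Finset.sum_ite_eq',
      Finset.mem_univ, if_true, add_right_inj] at k2
    apply hi
    have := (pow_left_inj₀ (u i).coe_nonneg (v i).coe_nonneg two_ne_zero).1 k2
    exact_mod_cast this
  · have hspan : ∀ {f}, f ∈ Submodule.span ℝ (Submonoid.closure
        {g : (ι → ℝ≥0) →ᵇ ℝ | ∃ t : ι → ℝ, ∃ ht, g = gaussianTest t ht} : Set _) → f ∈ A := by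
      intro f hf
      rwa [← Algebra.adjoin_eq_span] at hf
    intro g hg
    have hg' : g ∈ Algebra.adjoin ℝ {g | ∃ t : ι → ℝ, ∃ ht, g = gaussianTest t ht} := hg
    rw [← Subalgebra.mem_toSubmodule, Algebra.adjoin_eq_span] at hg'
    induction hg' using Submodule.span_induction with
    | mem f hf =>
      obtain rfl | ⟨t, ht, rfl⟩ := gaussianTest_mem_closure hf
      · simpa using h0
      · exact h t ht
    | zero => simp
    | add f f' hf hf' ih ih' =>
      simp only [BoundedContinuousFunction.add_apply]
      rw [integral_add (f.integrable μ) (f'.integrable μ),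
        integral_add (f.integrable ν) (f'.integrable ν), ih (hspan hf), ih' (hspan hf')]
    | smul c f hf ih =>
      simp only [BoundedContinuousFunction.smul_apply]
      rw [integral_smul, integral_smul, ih (hspan hf)]

/-- Transport along coordinates `q` that have an almost everywhere left inverse `p`: the
pushforwards agree, and pushing back by `p` recovers the measures. It is applied to the half-line
and to the orthant. -/
theorem ext_of_integral_gaussian {ι E : Type*} [Fintype ι] [MeasurableSpace E] {μ ν : Measure E}
    [IsFiniteMeasure μ] [IsFiniteMeasure ν] {q : E → ι → ℝ≥0} {p : (ι → ℝ≥0) → E}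
    (hq : Measurable q) (hp : Measurable p) (hμ : ∀ᵐ x ∂μ, p (q x) = x)
    (hν : ∀ᵐ x ∂ν, p (q x) = x) (h0 : μ.real univ = ν.real univ)
    (h : ∀ t : ι → ℝ, (∀ i, 0 < t i) → ∫ x, Real.exp (-∑ i, t i * (q x i : ℝ) ^ 2) ∂μ =
      ∫ x, Real.exp (-∑ i, t i * (q x i : ℝ) ^ 2) ∂ν) : μ = ν := by
  have key : μ.map q = ν.map q := by
    refine ext_of_integral_gaussianTest ?_ fun t ht => ?_
    · rw [map_measureReal_apply hq .univ, map_measureReal_apply hq .univ, preimage_univ, h0]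
    · have hc : Continuous fun u : ι → ℝ≥0 => Real.exp (-∑ i, t i * (u i : ℝ) ^ 2) := by fun_prop
      rw [integral_map hq.aemeasurable hc.measurable.aestronglyMeasurable,
        integral_map hq.aemeasurable hc.measurable.aestronglyMeasurable]
      exact h t ht
  have back : ∀ {ρ : Measure E}, (∀ᵐ x ∂ρ, p (q x) = x) → (ρ.map q).map p = ρ := by
    intro ρ hρ
    rw [Measure.map_map hp hq]
    conv_rhs => rw [← Measure.map_id (μ := ρ)]
    exact Measure.map_congr hρ
  rw [← back hμ, key, back hν]

/-! ### Weighted measures on the orthant and on the sphere -/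

open scoped ENNReal

/-- The measure `x ^ γ dx` on the orthant. -/
def orthantMeasure {n : ℕ} (γ : Fin n → ℝ) : Measure (EuclideanSpace ℝ (Fin n)) :=
  (volume.restrict (orthant n)).withDensity fun x => ENNReal.ofReal (weight γ x)

/-- The measure `ξ ^ γ dS` on the part of the sphere in the orthant. -/
def weightedSphere {n : ℕ} (γ : Fin n → ℝ) :
    Measure (Metric.sphere (0 : EuclideanSpace ℝ (Fin n)) 1) :=
  (sphereMeasure n).withDensity fun ξ => ENNReal.ofReal (weight γ ξ.1)

theorem measurableSet_orthant (n : ℕ) : MeasurableSet (orthant n) := by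
  have : orthant n = ⋂ i, {x : EuclideanSpace ℝ (Fin n) | 0 < x i} := by
    ext x
    simp [orthant]
  rw [this]
  exact MeasurableSet.iInter fun i => measurableSet_lt measurable_const (by fun_prop)

theorem measurable_weight {n : ℕ} (γ : Fin n → ℝ) : Measurable (weight γ) := by
  unfold weight
  fun_prop

theorem weight_pos {n : ℕ} (γ : Fin n → ℝ) {x : EuclideanSpace ℝ (Fin n)} (hx : x ∈ orthant n) :
    0 < weight γ x :=
  Finset.prod_pos fun i _ => Real.rpow_pos_of_pos (hx i) _

theorem weight_smul {n : ℕ} (γ : Fin n → ℝ) {x : EuclideanSpace ℝ (Fin n)} (hx : x ∈ orthant n)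
    {r : ℝ} (hr : 0 < r) : weight γ (r • x) = r ^ (∑ i, γ i) * weight γ x := by
  simp only [weight, PiLp.smul_apply, smul_eq_mul]
  rw [Real.rpow_sum_of_pos hr, ← Finset.prod_mul_distrib]
  exact Finset.prod_congr rfl fun i _ => Real.mul_rpow hr.le (hx i).le

theorem smul_mem_orthant_iff {n : ℕ} {x : EuclideanSpace ℝ (Fin n)} {r : ℝ} (hr : 0 < r) :
    r • x ∈ orthant n ↔ x ∈ orthant n := by
  simp [orthant, hr]

theorem measurableSet_sphere_orthant (n : ℕ) :
    MeasurableSet {ξ : Metric.sphere (0 : EuclideanSpace ℝ (Fin n)) 1 | ξ.1 ∈ orthant n} :=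
  measurable_subtype_coe (measurableSet_orthant n)

theorem ae_sphereMeasure (n : ℕ) : ∀ᵐ ξ ∂sphereMeasure n, ξ.1 ∈ orthant n :=
  ae_restrict_mem (measurableSet_sphere_orthant n)

theorem ae_weightedSphere {n : ℕ} (γ : Fin n → ℝ) : ∀ᵐ ξ ∂weightedSphere γ, ξ.1 ∈ orthant n :=
  (withDensity_absolutelyContinuous _ _).ae_le (ae_sphereMeasure n)

theorem ae_orthantMeasure {n : ℕ} (γ : Fin n → ℝ) : ∀ᵐ x ∂orthantMeasure γ, x ∈ orthant n :=
  (withDensity_absolutelyContinuous _ _).ae_le (ae_restrict_mem (measurableSet_orthant n))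

instance (n : ℕ) : IsFiniteMeasure (sphereMeasure n) := by
  unfold sphereMeasure
  infer_instance

instance {n : ℕ} (γ : Fin n → ℝ) : SigmaFinite (orthantMeasure γ) := by
  unfold orthantMeasure
  exact SigmaFinite.withDensity_of_ne_top (by simp)

theorem measurable_weight_sphere {n : ℕ} (γ : Fin n → ℝ) : Measurable
    fun ξ : Metric.sphere (0 : EuclideanSpace ℝ (Fin n)) 1 => weight γ ξ.1 :=
  (measurable_weight γ).comp measurable_subtype_coe

section Integrals

variable {E : Type*} [NormedAddCommGroup E] [NormedSpace ℝ E] {n : ℕ} (γ : Fin n → ℝ)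

theorem integral_orthantMeasure (f : EuclideanSpace ℝ (Fin n) → E) :
    ∫ x, f x ∂orthantMeasure γ = ∫ x in orthant n, weight γ x • f x := by
  rw [orthantMeasure, integral_withDensity_eq_integral_toReal_smul
    (measurable_weight γ).ennreal_ofReal (by simp)]
  refine setIntegral_congr_fun (measurableSet_orthant n) fun x hx => ?_
  rw [ENNReal.toReal_ofReal (weight_pos γ hx).le]

theorem integrable_orthantMeasure_iff (f : EuclideanSpace ℝ (Fin n) → E) :
    Integrable f (orthantMeasure γ) ↔ IntegrableOn (fun x => weight γ x • f x) (orthant n) := by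
  rw [orthantMeasure, integrable_withDensity_iff_integrable_smul'
    (measurable_weight γ).ennreal_ofReal (by simp)]
  refine integrableOn_congr_fun (fun x hx => ?_) (measurableSet_orthant n)
  rw [ENNReal.toReal_ofReal (weight_pos γ hx).le]

theorem integral_weightedSphere (f : Metric.sphere (0 : EuclideanSpace ℝ (Fin n)) 1 → E) :
    ∫ ξ, f ξ ∂weightedSphere γ = ∫ ξ, weight γ ξ.1 • f ξ ∂sphereMeasure n := by
  rw [weightedSphere, integral_withDensity_eq_integral_toReal_smul
    (measurable_weight_sphere γ).ennreal_ofReal (by simp)]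
  refine integral_congr_ae ?_
  filter_upwards [ae_sphereMeasure n] with ξ hξ
  rw [ENNReal.toReal_ofReal (weight_pos γ hξ).le]

end Integrals

theorem isFiniteMeasure_weightedSphere {n : ℕ} {γ : Fin n → ℝ} (hγ : ∀ i, 0 < γ i) :
    IsFiniteMeasure (weightedSphere γ) := by
  refine isFiniteMeasure_withDensity_ofReal (Integrable.hasFiniteIntegral ?_)
  refine (integrable_const (1 : ℝ)).mono' (measurable_weight_sphere γ).aestronglyMeasurable ?_
  filter_upwards [ae_sphereMeasure n] with ξ hξ
  rw [Real.norm_of_nonneg (weight_pos γ hξ).le]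
  refine Finset.prod_le_one (fun i _ => Real.rpow_nonneg (hξ i).le _) fun i _ => ?_
  refine Real.rpow_le_one (hξ i).le ?_ (hγ i).le
  have h1 := PiLp.norm_apply_le ξ.1 i
  have h2 : ‖ξ.1‖ = 1 := by simp
  rw [h2, Real.norm_eq_abs] at h1
  exact (le_abs_self _).trans h1

theorem weightedSphere_real_univ {n : ℕ} (γ : Fin n → ℝ) :
    (weightedSphere γ).real univ = sphereArea γ := by
  have h := integral_weightedSphere γ (fun _ => (1 : ℝ))
  rw [sphereArea]
  simpa using h

section Products

variable {𝕜 : Type*} [RCLike 𝕜] {n : ℕ} (γ : Fin n → ℝ)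

/-- Extension by zero factorizes over the coordinates, which reduces integrals of product functions
over the orthant to Fubini on `ℝⁿ`. -/
theorem indicator_orthant_weight_prod (f : Fin n → ℝ → 𝕜) (x : EuclideanSpace ℝ (Fin n)) :
    (orthant n).indicator (fun x => weight γ x • ∏ i, f i (x i)) x =
      ∏ i, (Ioi (0 : ℝ)).indicator (fun r => r ^ γ i • f i r) (x i) := by
  by_cases hx : x ∈ orthant n
  · rw [indicator_of_mem hx]
    have : ∀ i ∈ Finset.univ, (Ioi (0 : ℝ)).indicator (fun r => r ^ γ i • f i r) (x i) =
        ((x i ^ γ i : ℝ) : 𝕜) * f i (x i) := by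
      intro i _
      rw [indicator_of_mem (by exact hx i), RCLike.real_smul_eq_coe_mul]
    rw [Finset.prod_congr rfl this, Finset.prod_mul_distrib, weight, RCLike.real_smul_eq_coe_mul,
      RCLike.ofReal_prod]
  · rw [indicator_of_notMem hx]
    obtain ⟨i, hi⟩ : ∃ i, ¬ 0 < x i := by simpa [orthant] using hx
    exact (Finset.prod_eq_zero (Finset.mem_univ i) (indicator_of_notMem (by exact hi) _)).symm

theorem integral_orthantMeasure_prod (f : Fin n → ℝ → 𝕜) :
    ∫ x, ∏ i, f i (x i) ∂orthantMeasure γ = ∏ i, ∫ r, f i r ∂radialMeasure (γ i) := by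
  rw [integral_orthantMeasure, ← integral_indicator (measurableSet_orthant n)]
  simp only [indicator_orthant_weight_prod]
  rw [← (PiLp.volume_preserving_toLp (Fin n)).integral_comp
    (MeasurableEquiv.toLp 2 (Fin n → ℝ)).measurableEmbedding]
  simp only
  rw [integral_fintype_prod_volume_eq_prod
    (fun i => (Ioi (0 : ℝ)).indicator (fun r => r ^ γ i • f i r))]
  simp only [integral_indicator measurableSet_Ioi, integral_radialMeasure]

theorem integrable_orthantMeasure_prod {f : Fin n → ℝ → 𝕜}
    (hf : ∀ i, Integrable (f i) (radialMeasure (γ i))) :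
    Integrable (fun x : EuclideanSpace ℝ (Fin n) => ∏ i, f i (x i)) (orthantMeasure γ) := by
  rw [integrable_orthantMeasure_iff, ← integrable_indicator_iff (measurableSet_orthant n)]
  simp only [funext (indicator_orthant_weight_prod γ f)]
  rw [← (PiLp.volume_preserving_toLp (Fin n)).integrable_comp_emb
    (MeasurableEquiv.toLp 2 (Fin n → ℝ)).measurableEmbedding]
  exact Integrable.fintype_prod
    (f := fun i => (Ioi (0 : ℝ)).indicator (fun r => r ^ γ i • f i r)) fun i =>
    (integrable_indicator_iff measurableSet_Ioi).2 ((integrable_radialMeasure_iff _ _).1 (hf i))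

end Products

theorem lintegral_polar {n : ℕ} {g : EuclideanSpace ℝ (Fin n) → ℝ≥0∞} (hg : Measurable g)
    (hn : 0 < n) :
    ∫⁻ x, g x = ∫⁻ θ, (∫⁻ r in Ioi (0 : ℝ), ENNReal.ofReal (r ^ (n - 1)) * g (r • θ.1))
      ∂(volume : Measure (EuclideanSpace ℝ (Fin n))).toSphere := by
  have : Nontrivial (EuclideanSpace ℝ (Fin n)) := by
    have : Nonempty (Fin n) := ⟨⟨0, hn⟩⟩
    infer_instance
  have hmp := (volume : Measure (EuclideanSpace ℝ (Fin n))).measurePreserving_homeomorphUnitSphereProd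
  have hm0 : MeasurableSet ({0}ᶜ : Set (EuclideanSpace ℝ (Fin n))) :=
    (measurableSet_singleton _).compl
  calc ∫⁻ x, g x = ∫⁻ x in ({0}ᶜ : Set _), g x := by rw [restrict_compl_singleton]
    _ = ∫⁻ x : ({0}ᶜ : Set (EuclideanSpace ℝ (Fin n))), g x ∂(volume.comap Subtype.val) :=
      (lintegral_subtype_comap hm0 g).symm
    _ = ∫⁻ p : Metric.sphere (0 : EuclideanSpace ℝ (Fin n)) 1 × Ioi (0 : ℝ), g (p.2.1 • p.1.1)
        ∂((volume : Measure (EuclideanSpace ℝ (Fin n))).toSphere.prod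
          (Measure.volumeIoiPow (Module.finrank ℝ (EuclideanSpace ℝ (Fin n)) - 1))) := by
      rw [← hmp.lintegral_comp (by fun_prop)]
      refine lintegral_congr fun x => ?_
      congr 1
      exact (congrArg Subtype.val
        ((homeomorphUnitSphereProd (EuclideanSpace ℝ (Fin n))).symm_apply_apply x)).symm
    _ = _ := by
      rw [lintegral_prod _ (by fun_prop)]
      refine lintegral_congr fun θ => ?_
      rw [Measure.volumeIoiPow, lintegral_withDensity_eq_lintegral_mul _ (by fun_prop) (by fun_prop),
        finrank_euclideanSpace_fin]
      exact lintegral_subtype_comap measurableSet_Ioi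
        (fun r => ENNReal.ofReal (r ^ (n - 1)) * g (r • θ.1))

/-- The dimension parameter of the radial measure in polar coordinates. -/
def polarExponent {n : ℕ} (γ : Fin n → ℝ) : ℝ := n + ∑ i, γ i - 1

theorem polarExponent_pos {n : ℕ} (hn : 0 < n) {γ : Fin n → ℝ} (hγ : ∀ i, 0 < γ i) :
    0 < polarExponent γ := by
  have h1 : (1 : ℝ) ≤ n := by exact_mod_cast hn
  have : Nonempty (Fin n) := ⟨⟨0, hn⟩⟩
  have := Finset.sum_pos (fun i _ => hγ i) (Finset.univ_nonempty (α := Fin n))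
  unfold polarExponent
  linarith

/-- Polar coordinates for `x ^ γ dx` on the orthant. -/
theorem lintegral_orthantMeasure {n : ℕ} (hn : 0 < n) (γ : Fin n → ℝ)
    {g : EuclideanSpace ℝ (Fin n) → ℝ≥0∞} (hg : Measurable g) :
    ∫⁻ x, g x ∂orthantMeasure γ =
      ∫⁻ θ, ∫⁻ r, g (r • θ.1) ∂radialMeasure (polarExponent γ) ∂weightedSphere γ := by
  have hw := measurable_weight γ
  have hin : Measurable fun θ : Metric.sphere (0 : EuclideanSpace ℝ (Fin n)) 1 =>
      ∫⁻ r, g (r • θ.1) ∂radialMeasure (polarExponent γ) :=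
    Measurable.lintegral_prod_right' (f := fun p : Metric.sphere (0 : EuclideanSpace ℝ (Fin n)) 1 ×
      ℝ => g (p.2 • p.1.1)) (by fun_prop)
  rw [orthantMeasure, lintegral_withDensity_eq_lintegral_mul _ hw.ennreal_ofReal hg,
    ← lintegral_indicator (measurableSet_orthant n),
    lintegral_polar ((hw.ennreal_ofReal.mul hg).indicator (measurableSet_orthant n)) hn,
    weightedSphere, lintegral_withDensity_eq_lintegral_mul _
      (measurable_weight_sphere γ).ennreal_ofReal hin,
    sphereMeasure, ← lintegral_indicator (measurableSet_sphere_orthant n)]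
  refine lintegral_congr fun θ => ?_
  by_cases hθ : θ.1 ∈ orthant n
  · rw [indicator_of_mem (by exact hθ), Pi.mul_apply, radialMeasure,
      lintegral_withDensity_eq_lintegral_mul _ (by fun_prop) (by fun_prop),
      ← lintegral_const_mul _ (by fun_prop)]
    refine setLIntegral_congr_fun measurableSet_Ioi fun r hr => ?_
    simp only [mem_Ioi] at hr
    rw [indicator_of_mem (by rwa [smul_mem_orthant_iff hr]), Pi.mul_apply, Pi.mul_apply,
      weight_smul γ hθ hr, ← mul_assoc, ← mul_assoc, ← ENNReal.ofReal_mul (by positivity),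
      ← ENNReal.ofReal_mul (weight_pos γ hθ).le]
    congr 2
    have : r ^ polarExponent γ = r ^ (n - 1) * r ^ (∑ i, γ i) := by
      rw [← Real.rpow_natCast, ← Real.rpow_add hr, polarExponent, Nat.cast_sub hn]
      congr 1
      push_cast
      ring
    rw [this]
    ring
  · rw [indicator_of_notMem (by exact hθ)]
    refine (setLIntegral_congr_fun measurableSet_Ioi fun r hr => ?_).trans lintegral_zero
    simp only [mem_Ioi] at hr
    rw [indicator_of_notMem (by rwa [smul_mem_orthant_iff hr]), mul_zero]

theorem map_polar {n : ℕ} (hn : 0 < n) {γ : Fin n → ℝ} (hγ : ∀ i, 0 < γ i) :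
    ((weightedSphere γ).prod (radialMeasure (polarExponent γ))).map (fun p => p.2 • p.1.1) =
      orthantMeasure γ := by
  have := isFiniteMeasure_weightedSphere hγ
  refine Measure.ext_of_lintegral _ fun g hg => ?_
  rw [lintegral_map hg (by fun_prop), lintegral_prod _ (by fun_prop),
    lintegral_orthantMeasure hn γ hg]

/-! ### Spherical means of the Bessel kernel -/

/-- Adding the bound `A` makes both functions nonnegative, and the factor `exp(-r²)` turns them into
densities of finite measures. Their Gaussian integrals at `t` are the given ones at `s = t + 1`, so
the measures agree; equality of densities almost everywhere becomes pointwise by continuity. -/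
theorem eqOn_of_integral_gaussian {p A : ℝ} (hp : 0 < p) {f g : ℝ → ℝ} (hf : Continuous f)
    (hg : Continuous g) (hfA : ∀ r, |f r| ≤ A) (hgA : ∀ r, |g r| ≤ A)
    (h : ∀ s : ℝ, 0 < s → ∫ r, f r * Real.exp (-s * r ^ 2) ∂radialMeasure p =
      ∫ r, g r * Real.exp (-s * r ^ 2) ∂radialMeasure p) : EqOn f g (Ioi 0) := by
  have hexp : ∀ s : ℝ, 0 < s → Integrable (fun r => Real.exp (-s * r ^ 2)) (radialMeasure p) := by
    intro s hs
    simpa using integrable_radial_exp hp hs 0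
  have hint : ∀ {u : ℝ → ℝ}, Continuous u → (∀ r, |u r| ≤ A) → ∀ s : ℝ, 0 < s →
      Integrable (fun r => u r * Real.exp (-s * r ^ 2)) (radialMeasure p) := by
    intro u hu huA s hs
    refine ((hexp s hs).const_mul A).mono' (by fun_prop) (ae_of_all _ fun r => ?_)
    rw [norm_mul, Real.norm_of_nonneg (Real.exp_pos _).le, Real.norm_eq_abs]
    gcongr
    exact huA r
  have hnn : ∀ {u : ℝ → ℝ}, (∀ r, |u r| ≤ A) → ∀ r, 0 ≤ (u r + A) * Real.exp (-1 * r ^ 2) :=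
    fun huA r => mul_nonneg (by linarith [neg_le_of_abs_le (huA r)]) (Real.exp_pos _).le
  have hsum : ∀ {u : ℝ → ℝ}, Continuous u → (∀ r, |u r| ≤ A) → ∀ s : ℝ, 0 < s →
      ∫ r, (u r + A) * Real.exp (-s * r ^ 2) ∂radialMeasure p =
        ∫ r, u r * Real.exp (-s * r ^ 2) ∂radialMeasure p +
          A * ∫ r, Real.exp (-s * r ^ 2) ∂radialMeasure p := by
    intro u hu huA s hs
    simp only [add_mul]
    rw [integral_add (hint hu huA s hs) ((hexp s hs).const_mul A), integral_const_mul]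
  have hsi : ∀ {u : ℝ → ℝ}, Continuous u → (∀ r, |u r| ≤ A) →
      Integrable (fun r => (u r + A) * Real.exp (-1 * r ^ 2)) (radialMeasure p) := by
    intro u hu huA
    simp only [add_mul]
    exact (hint hu huA 1 one_pos).add ((hexp 1 one_pos).const_mul A)
  have hden : ∀ {u : ℝ → ℝ}, Continuous u → (∀ r, |u r| ≤ A) → ∀ t : ℝ, 0 ≤ t →
      ∫ r, Real.exp (-(t * r ^ 2)) ∂((radialMeasure p).withDensity
        fun r => ENNReal.ofReal ((u r + A) * Real.exp (-1 * r ^ 2))) =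
      ∫ r, (u r + A) * Real.exp (-(t + 1) * r ^ 2) ∂radialMeasure p := by
    intro u hu huA t ht
    rw [integral_withDensity_eq_integral_toReal_smul (by fun_prop) (by simp)]
    refine integral_congr_ae (ae_of_all _ fun r => ?_)
    simp only
    rw [ENNReal.toReal_ofReal (hnn huA r), smul_eq_mul, mul_assoc, ← Real.exp_add]
    ring_nf
  have key : (radialMeasure p).withDensity
        (fun r => ENNReal.ofReal ((f r + A) * Real.exp (-1 * r ^ 2))) =
      (radialMeasure p).withDensity
        (fun r => ENNReal.ofReal ((g r + A) * Real.exp (-1 * r ^ 2))) := by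
    have := isFiniteMeasure_withDensity_ofReal (hsi hf hfA).hasFiniteIntegral
    have := isFiniteMeasure_withDensity_ofReal (hsi hg hgA).hasFiniteIntegral
    have hr : ∀ d : ℝ → ENNReal, ∀ᵐ r ∂((radialMeasure p).withDensity d),
        ((Real.toNNReal r : NNReal) : ℝ) = r := by
      intro d
      filter_upwards [(withDensity_absolutelyContinuous _ _).ae_le (ae_radialMeasure p)] with r hr
      exact Real.coe_toNNReal r hr.le
    have hall : ∀ t : ℝ, 0 ≤ t → ∫ r, Real.exp (-(t * r ^ 2)) ∂((radialMeasure p).withDensity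
        fun r => ENNReal.ofReal ((f r + A) * Real.exp (-1 * r ^ 2))) =
        ∫ r, Real.exp (-(t * r ^ 2)) ∂((radialMeasure p).withDensity
        fun r => ENNReal.ofReal ((g r + A) * Real.exp (-1 * r ^ 2))) := by
      intro t ht
      rw [hden hf hfA t ht, hden hg hgA t ht, hsum hf hfA _ (by linarith),
        hsum hg hgA _ (by linarith), h _ (by linarith)]
    refine ext_of_integral_gaussian (ι := Unit) (q := fun r _ => Real.toNNReal r)
      (p := fun u => (u () : ℝ)) (by fun_prop) (by fun_prop) (hr _) (hr _) ?_ fun t ht => ?_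
    · simpa using hall 0 le_rfl
    · simp only [Finset.univ_unique, Finset.sum_singleton]
      have hc : ∀ d : ℝ → ENNReal, ∫ r, Real.exp (-(t default * ((Real.toNNReal r : NNReal) : ℝ) ^ 2))
          ∂((radialMeasure p).withDensity d) =
          ∫ r, Real.exp (-(t default * r ^ 2)) ∂((radialMeasure p).withDensity d) := by
        intro d
        refine integral_congr_ae ?_
        filter_upwards [hr d] with r hr
        rw [hr]
      rw [hc, hc]
      exact hall _ (ht _).le
  have hae := (withDensity_eq_iff (by fun_prop) (by fun_prop)
    (hsi hf hfA).lintegral_lt_top.ne).1 key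
  have hae2 : ∀ᵐ r ∂(volume.restrict (Ioi (0 : ℝ))), f r = g r := by
    unfold radialMeasure at hae
    rw [Filter.EventuallyEq, ae_withDensity_iff (by fun_prop)] at hae
    filter_upwards [hae, ae_restrict_mem measurableSet_Ioi] with r hr hr0
    have h1 := hr (ne_of_gt (ENNReal.ofReal_pos.2 (Real.rpow_pos_of_pos hr0 _)))
    rw [ENNReal.ofReal_eq_ofReal_iff (hnn hfA r) (hnn hgA r)] at h1
    linarith [mul_right_cancel₀ (Real.exp_pos _).ne' h1]
  exact Measure.eqOn_open_of_ae_eq hae2 isOpen_Ioi hf.continuousOn hg.continuousOn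

theorem integral_polar {E : Type*} [NormedAddCommGroup E] [NormedSpace ℝ E] {n : ℕ} (hn : 0 < n)
    {γ : Fin n → ℝ} (hγ : ∀ i, 0 < γ i) {f : EuclideanSpace ℝ (Fin n) → E}
    (hf : Integrable f (orthantMeasure γ)) :
    ∫ x, f x ∂orthantMeasure γ =
      ∫ r, ∫ θ, f (r • θ.1) ∂weightedSphere γ ∂radialMeasure (polarExponent γ) := by
  have := isFiniteMeasure_weightedSphere hγ
  have hm : Measurable fun p : Metric.sphere (0 : EuclideanSpace ℝ (Fin n)) 1 × ℝ =>
    p.2 • p.1.1 := by fun_prop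
  rw [← map_polar hn hγ] at hf ⊢
  rw [integral_map hm.aemeasurable hf.aestronglyMeasurable]
  exact integral_prod_symm _
    ((integrable_map_measure hf.aestronglyMeasurable hm.aemeasurable).1 hf)

theorem exp_neg_mul_norm_sq {n : ℕ} (s : ℝ) (x : EuclideanSpace ℝ (Fin n)) :
    Real.exp (-s * ‖x‖ ^ 2) = ∏ i, Real.exp (-s * x i ^ 2) := by
  rw [← Real.exp_sum, ← Finset.mul_sum, EuclideanSpace.real_norm_sq_eq]

section Kernel

variable {n : ℕ} {γ : Fin n → ℝ}

theorem abs_besselKernel_le (hγ : ∀ i, 0 < γ i) (x η : EuclideanSpace ℝ (Fin n)) :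
    |besselKernel γ x η| ≤ 1 := by
  rw [besselKernel, Finset.abs_prod]
  exact Finset.prod_le_one (fun i _ => abs_nonneg _) fun i _ => abs_smallBessel_le (hγ i) _

theorem continuous_besselKernel (hγ : ∀ i, 0 < γ i) :
    Continuous fun p : EuclideanSpace ℝ (Fin n) × EuclideanSpace ℝ (Fin n) =>
      besselKernel γ p.1 p.2 := by
  unfold besselKernel
  refine continuous_finsetProd _ fun i _ => ?_
  exact (continuous_smallBessel (hγ i)).comp (by fun_prop)

theorem besselKernel_zero (hγ : ∀ i, 0 < γ i) (x : EuclideanSpace ℝ (Fin n)) :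
    besselKernel γ x 0 = 1 := by
  simp [besselKernel, smallBessel_zero (hγ _)]

theorem besselKernel_comm (x η : EuclideanSpace ℝ (Fin n)) :
    besselKernel γ x η = besselKernel γ η x := by
  simp only [besselKernel, mul_comm]

theorem integrable_gaussian_orthant (hγ : ∀ i, 0 < γ i) {s : ℝ} (hs : 0 < s) :
    Integrable (fun x => Real.exp (-s * ‖x‖ ^ 2)) (orthantMeasure γ) := by
  simp only [exp_neg_mul_norm_sq]
  refine integrable_orthantMeasure_prod γ (f := fun i r => Real.exp (-s * r ^ 2)) fun i => ?_
  simpa using integrable_radial_exp (hγ i) hs 0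

theorem integrable_besselKernel_gaussian (hγ : ∀ i, 0 < γ i) (η : EuclideanSpace ℝ (Fin n))
    {s : ℝ} (hs : 0 < s) :
    Integrable (fun x => besselKernel γ x η * Real.exp (-s * ‖x‖ ^ 2)) (orthantMeasure γ) := by
  have hc : Continuous fun x => besselKernel γ x η :=
    (continuous_besselKernel hγ).comp (Continuous.prodMk_left η)
  refine (integrable_gaussian_orthant hγ hs).mono'
    (Continuous.aestronglyMeasurable (by fun_prop)) (ae_of_all _ fun x => ?_)
  rw [norm_mul, Real.norm_of_nonneg (Real.exp_pos _).le]
  exact mul_le_of_le_one_left (Real.exp_pos _).le (abs_besselKernel_le hγ x η)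

/-- The `n`-dimensional form of Weber's first exponential integral. -/
theorem integral_besselKernel_gaussian (hγ : ∀ i, 0 < γ i) (η : EuclideanSpace ℝ (Fin n))
    {s : ℝ} (hs : 0 < s) :
    ∫ x, besselKernel γ x η * Real.exp (-s * ‖x‖ ^ 2) ∂orthantMeasure γ =
      (∏ i, Real.Gamma ((γ i + 1) / 2)) / (2 ^ n * s ^ ((polarExponent γ + 1) / 2)) *
        Real.exp (-‖η‖ ^ 2 / (4 * s)) := by
  simp only [exp_neg_mul_norm_sq, besselKernel, ← Finset.prod_mul_distrib]
  rw [integral_orthantMeasure_prod γ (fun i r =>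
    smallBessel ((γ i - 1) / 2) (r * η i) * Real.exp (-s * r ^ 2))]
  simp only [integral_smallBessel_gaussian (hγ _) hs]
  rw [Finset.prod_mul_distrib, ← Real.exp_sum, Finset.prod_div_distrib, Finset.prod_mul_distrib,
    Finset.prod_const, Finset.card_univ, Fintype.card_fin, ← Real.rpow_sum_of_pos hs,
    ← Finset.sum_div, ← Finset.sum_div, Finset.sum_neg_distrib, ← EuclideanSpace.real_norm_sq_eq,
    Finset.sum_add_distrib]
  simp [polarExponent, add_comm]

/-- The weighted area of the part of the sphere in the orthant. -/
theorem sphereArea_mul_Gamma (hn : 0 < n) (hγ : ∀ i, 0 < γ i) :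
    sphereArea γ * Real.Gamma ((polarExponent γ + 1) / 2) * 2 ^ n =
      2 * ∏ i, Real.Gamma ((γ i + 1) / 2) := by
  have hp := polarExponent_pos hn hγ
  have h1 := integral_besselKernel_gaussian hγ 0 (s := 1) one_pos
  rw [integral_polar hn hγ (integrable_besselKernel_gaussian hγ 0 one_pos)] at h1
  have h2 : ∀ r : ℝ, ∫ θ, besselKernel γ (r • θ.1) 0 * Real.exp (-1 * ‖r • θ.1‖ ^ 2)
      ∂weightedSphere γ = Real.exp (-1 * r ^ 2) * sphereArea γ := by
    intro r
    simp [besselKernel_zero hγ, norm_smul, weightedSphere_real_univ, mul_comm]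
  simp only [h2, integral_mul_const, integral_radialMeasure, smul_eq_mul] at h1
  rw [integral_rpow_mul_exp_neg_sq (by linarith) one_pos] at h1
  simp at h1
  field_simp at h1
  linarith

/-- Both sides are bounded and continuous in `r`, so it suffices to compare Gaussian integrals
against `r^p dr`. On the left, polar coordinates turn these into the `n`-dimensional Weber integral;
on the right stands the one-dimensional one with parameter `p`. The area formula matches the
constants. -/
theorem integral_weightedSphere_besselKernel (hn : 0 < n) (hγ : ∀ i, 0 < γ i)
    (η : EuclideanSpace ℝ (Fin n)) {r : ℝ} (hr : 0 < r) :
    ∫ θ, besselKernel γ (r • θ.1) η ∂weightedSphere γ =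
      sphereArea γ * smallBessel ((polarExponent γ - 1) / 2) (r * ‖η‖) := by
  have hp := polarExponent_pos hn hγ
  have := isFiniteMeasure_weightedSphere hγ
  have hA : 0 ≤ sphereArea γ := by
    rw [← weightedSphere_real_univ]
    exact measureReal_nonneg
  have hc := continuous_besselKernel hγ
  have hcs := continuous_smallBessel hp
  refine eqOn_of_integral_gaussian hp (A := sphereArea γ)
    (f := fun r => ∫ θ, besselKernel γ (r • θ.1) η ∂weightedSphere γ)
    (g := fun r => sphereArea γ * smallBessel ((polarExponent γ - 1) / 2) (r * ‖η‖))
    ?_ (by fun_prop) (fun r => ?_) (fun r => ?_) (fun s hs => ?_) hr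
  · refine continuous_of_dominated (bound := fun _ => 1) (fun r => ?_)
      (fun r => ae_of_all _ fun θ => abs_besselKernel_le hγ _ _) (integrable_const _)
      (ae_of_all _ fun θ => ?_)
    · exact (hc.comp (g := fun p => besselKernel γ p.1 p.2)
        (f := fun θ : Metric.sphere (0 : EuclideanSpace ℝ (Fin n)) 1 => (r • θ.1, η))
          (by fun_prop)).aestronglyMeasurable
    · exact hc.comp (g := fun p => besselKernel γ p.1 p.2) (f := fun r : ℝ => (r • θ.1, η))
        (by fun_prop)
  · rw [← Real.norm_eq_abs, ← weightedSphere_real_univ]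
    refine (norm_integral_le_of_norm_le_const (C := 1)
      (ae_of_all _ fun θ => abs_besselKernel_le hγ _ _)).trans ?_
    rw [one_mul]
  · rw [abs_mul, abs_of_nonneg hA]
    exact mul_le_of_le_one_right hA (abs_smallBessel_le hp _)
  · have h1 := integral_besselKernel_gaussian hγ η hs
    rw [integral_polar hn hγ (integrable_besselKernel_gaussian hγ η hs)] at h1
    have h2 : ∀ r : ℝ, ∫ θ, besselKernel γ (r • θ.1) η * Real.exp (-s * ‖r • θ.1‖ ^ 2)
        ∂weightedSphere γ = (∫ θ, besselKernel γ (r • θ.1) η ∂weightedSphere γ) *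
          Real.exp (-s * r ^ 2) := by
      intro r
      rw [← integral_mul_const]
      simp [norm_smul]
    simp only [h2] at h1
    simp only [mul_assoc (sphereArea γ), integral_const_mul]
    rw [h1, integral_smallBessel_gaussian hp hs, ← mul_assoc]
    congr 1
    have h3 := sphereArea_mul_Gamma hn hγ
    have := Real.Gamma_pos_of_pos (show 0 < (polarExponent γ + 1) / 2 by positivity)
    field_simp
    linarith

end Kernel

/-! ### Inversion of the Fourier–Bessel transform -/

open scoped Topology

theorem fourierBessel_eq {n : ℕ} (γ : Fin n → ℝ) (f : EuclideanSpace ℝ (Fin n) → ℂ)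
    (ξ : EuclideanSpace ℝ (Fin n)) :
    fourierBessel γ f ξ = ∫ x, besselKernel γ x ξ • f x ∂orthantMeasure γ := by
  rw [integral_orthantMeasure, fourierBessel]
  refine integral_congr_ae (ae_of_all _ fun x => ?_)
  simp only [Complex.real_smul]
  push_cast
  ring

section Inversion

variable {n : ℕ} {γ : Fin n → ℝ}

theorem continuous_besselKernel_left (hγ : ∀ i, 0 < γ i) (η : EuclideanSpace ℝ (Fin n)) :
    Continuous fun x => besselKernel γ x η :=
  (continuous_besselKernel hγ).comp (Continuous.prodMk_left η)

theorem continuous_besselKernel_right (hγ : ∀ i, 0 < γ i) (x : EuclideanSpace ℝ (Fin n)) :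
    Continuous fun η => besselKernel γ x η :=
  (continuous_besselKernel hγ).comp (Continuous.prodMk_right x)

theorem norm_besselKernel_smul_le (hγ : ∀ i, 0 < γ i) (x η : EuclideanSpace ℝ (Fin n)) (z : ℂ) :
    ‖besselKernel γ x η • z‖ ≤ ‖z‖ := by
  rw [norm_smul]
  exact mul_le_of_le_one_left (norm_nonneg _) (abs_besselKernel_le hγ x η)

theorem continuous_fourierBessel (hγ : ∀ i, 0 < γ i) {F : EuclideanSpace ℝ (Fin n) → ℂ}
    (hF : Integrable F (orthantMeasure γ)) : Continuous (fourierBessel γ F) := by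
  simp only [funext (fourierBessel_eq γ F)]
  refine continuous_of_dominated (bound := fun x => ‖F x‖) (fun ξ => ?_)
    (fun ξ => ae_of_all _ fun x => norm_besselKernel_smul_le hγ _ _ _) hF.norm
    (ae_of_all _ fun x => (continuous_besselKernel_right hγ x).smul continuous_const)
  exact (continuous_besselKernel_left hγ ξ).aestronglyMeasurable.smul hF.aestronglyMeasurable

theorem norm_fourierBessel_le (hγ : ∀ i, 0 < γ i) {F : EuclideanSpace ℝ (Fin n) → ℂ}
    (hF : Integrable F (orthantMeasure γ)) (ξ : EuclideanSpace ℝ (Fin n)) :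
    ‖fourierBessel γ F ξ‖ ≤ ∫ x, ‖F x‖ ∂orthantMeasure γ := by
  rw [fourierBessel_eq]
  exact norm_integral_le_of_norm_le hF.norm
    (ae_of_all _ fun x => norm_besselKernel_smul_le hγ _ _ _)

/-- The mass `∫ exp (-s |x| ^ 2) x ^ γ dx` over the orthant. -/
def gaussianMass (γ : Fin n → ℝ) (s : ℝ) : ℝ :=
  ∏ i, Real.Gamma ((γ i + 1) / 2) / (2 * s ^ ((γ i + 1) / 2))

/-- The generalized translation of the Gaussian `exp (-b |z| ^ 2)`. -/
def heatKernel (γ : Fin n → ℝ) (b : ℝ) (y z : EuclideanSpace ℝ (Fin n)) : ℝ :=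
  ∏ i, translatedGaussian (γ i) b (y i) (z i)

theorem gaussianMass_pos (hγ : ∀ i, 0 < γ i) {s : ℝ} (hs : 0 < s) : 0 < gaussianMass γ s := by
  refine Finset.prod_pos fun i _ => ?_
  have := Real.Gamma_pos_of_pos (show 0 < (γ i + 1) / 2 by linarith [hγ i])
  positivity

theorem inv_gaussianMass (γ : Fin n → ℝ) {s : ℝ} (hs : 0 < s) :
    (gaussianMass γ s)⁻¹ = (gaussianMass γ 1)⁻¹ * s ^ (∑ i, (γ i + 1) / 2) := by
  rw [gaussianMass, gaussianMass, Real.rpow_sum_of_pos hs, ← Finset.prod_inv_distrib,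
    ← Finset.prod_inv_distrib, ← Finset.prod_mul_distrib]
  refine Finset.prod_congr rfl fun i _ => ?_
  rw [Real.one_rpow, inv_div, inv_div]
  ring

/-- The powers of `b` cancel, leaving the constant of the inversion formula. -/
theorem gaussianMass_mul_gaussianMass (γ : Fin n → ℝ) {b : ℝ} (hb : 0 < b) :
    gaussianMass γ (1 / (4 * b)) * gaussianMass γ b =
      2 ^ (∑ i, γ i - n) * (∏ i, Real.Gamma ((γ i + 1) / 2)) ^ 2 := by
  have e : (2 : ℝ) ^ (∑ i, γ i - n) = ∏ i, (2 : ℝ) ^ (γ i - 1) := by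
    rw [← Real.rpow_sum_of_pos two_pos, Finset.sum_sub_distrib]
    simp
  rw [gaussianMass, gaussianMass, e, ← Finset.prod_pow, ← Finset.prod_mul_distrib,
    ← Finset.prod_mul_distrib]
  refine Finset.prod_congr rfl fun i _ => ?_
  rw [Real.div_rpow zero_le_one (by positivity), Real.one_rpow, Real.mul_rpow (by norm_num) hb.le,
    show (4 : ℝ) = 2 ^ (2 : ℝ) by norm_num, ← Real.rpow_mul two_pos.le,
    show 2 * ((γ i + 1) / 2) = (γ i - 1) + 2 by ring, Real.rpow_add two_pos]
  field_simp
  norm_num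
  ring

theorem heatKernel_nonneg (γ : Fin n → ℝ) (b : ℝ) (y z : EuclideanSpace ℝ (Fin n)) :
    0 ≤ heatKernel γ b y z :=
  Finset.prod_nonneg fun _ _ => translatedGaussian_nonneg _ _ _ _

theorem heatKernel_le (hγ : ∀ i, 0 < γ i) {b : ℝ} (hb : 0 < b) {y z : EuclideanSpace ℝ (Fin n)}
    (hy : y ∈ orthant n) (hz : z ∈ orthant n) :
    heatKernel γ b y z ≤ Real.exp (-b * ‖z - y‖ ^ 2) := by
  rw [exp_neg_mul_norm_sq]
  exact Finset.prod_le_prod (fun _ _ => translatedGaussian_nonneg _ _ _ _) fun i _ =>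
    translatedGaussian_le (hγ i) hb (mul_nonneg (hy i).le (hz i).le)

theorem continuous_heatKernel (hγ : ∀ i, 0 < γ i) {b : ℝ} (hb : 0 < b)
    (y : EuclideanSpace ℝ (Fin n)) : Continuous (heatKernel γ b y) := by
  unfold heatKernel
  exact continuous_finsetProd _ fun i _ =>
    (continuous_translatedGaussian (hγ i) hb (y i)).comp (by fun_prop)

theorem integral_heatKernel (hγ : ∀ i, 0 < γ i) {b : ℝ} (hb : 0 < b)
    (y : EuclideanSpace ℝ (Fin n)) :
    ∫ z, heatKernel γ b y z ∂orthantMeasure γ = gaussianMass γ b := by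
  simp only [heatKernel, gaussianMass]
  rw [integral_orthantMeasure_prod γ fun i z => translatedGaussian (γ i) b (y i) z]
  exact Finset.prod_congr rfl fun i _ => integral_translatedGaussian (hγ i) hb _

theorem integral_besselKernel_mul_gaussian (hγ : ∀ i, 0 < γ i) {s : ℝ} (hs : 0 < s)
    (y z : EuclideanSpace ℝ (Fin n)) :
    ∫ x, besselKernel γ x y * besselKernel γ x z * Real.exp (-s * ‖x‖ ^ 2) ∂orthantMeasure γ =
      gaussianMass γ s * heatKernel γ (1 / (4 * s)) y z := by
  simp only [exp_neg_mul_norm_sq, besselKernel, heatKernel, gaussianMass,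
    ← Finset.prod_mul_distrib]
  rw [integral_orthantMeasure_prod γ fun i r => smallBessel ((γ i - 1) / 2) (r * y i) *
    smallBessel ((γ i - 1) / 2) (r * z i) * Real.exp (-s * r ^ 2)]
  exact Finset.prod_congr rfl fun i _ => integral_smallBessel_mul_gaussian (hγ i) hs _ _

/-- Gaussian means of the inverse transform are averages against the heat kernel. -/
theorem integral_fourierBessel_gaussian (hγ : ∀ i, 0 < γ i)
    {F : EuclideanSpace ℝ (Fin n) → ℂ} (hF : Integrable F (orthantMeasure γ)) {b : ℝ} (hb : 0 < b)
    (y : EuclideanSpace ℝ (Fin n)) :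
    ∫ x, (besselKernel γ x y * Real.exp (-(1 / (4 * b)) * ‖x‖ ^ 2)) • fourierBessel γ F x
      ∂orthantMeasure γ =
    (2 ^ (∑ i, γ i - n) * (∏ i, Real.Gamma ((γ i + 1) / 2)) ^ 2) •
      ∫ z, ((gaussianMass γ b)⁻¹ * heatKernel γ b y z) • F z ∂orthantMeasure γ := by
  -- Weber's second integral inverts the width, so the regularizing parameter `1 / (4b)` yields the
  -- heat kernel with parameter `b`.
  have hs : 0 < 1 / (4 * b) := by positivity
  have hI : Integrable (fun p : EuclideanSpace ℝ (Fin n) × EuclideanSpace ℝ (Fin n) =>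
      (besselKernel γ p.1 y * Real.exp (-(1 / (4 * b)) * ‖p.1‖ ^ 2)) •
        (besselKernel γ p.2 p.1 • F p.2)) ((orthantMeasure γ).prod (orthantMeasure γ)) := by
    have h1 := (integrable_gaussian_orthant hγ hs).mul_prod hF.norm
    have hc := continuous_besselKernel hγ
    refine h1.mono' ?_ (ae_of_all _ fun p => ?_)
    · have hc1 : Continuous fun p : EuclideanSpace ℝ (Fin n) × EuclideanSpace ℝ (Fin n) =>
          besselKernel γ p.1 y * Real.exp (-(1 / (4 * b)) * ‖p.1‖ ^ 2) :=
        ((continuous_besselKernel_left hγ y).comp continuous_fst).mul (by fun_prop)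
      have hc2 : Continuous fun p : EuclideanSpace ℝ (Fin n) × EuclideanSpace ℝ (Fin n) =>
          besselKernel γ p.2 p.1 := hc.comp (continuous_snd.prodMk continuous_fst)
      exact hc1.aestronglyMeasurable.smul
        (hc2.aestronglyMeasurable.smul hF.aestronglyMeasurable.comp_snd)
    · rw [norm_smul, norm_mul, Real.norm_of_nonneg (Real.exp_pos _).le]
      refine mul_le_mul ?_ (norm_besselKernel_smul_le hγ _ _ _) (norm_nonneg _)
        (Real.exp_pos _).le
      exact mul_le_of_le_one_left (Real.exp_pos _).le (abs_besselKernel_le hγ _ _)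
  simp only [fourierBessel_eq, ← integral_smul]
  rw [integral_integral_swap hI]
  refine integral_congr_ae (ae_of_all _ fun z => ?_)
  simp only [smul_smul]
  rw [integral_smul_const]
  congr 1
  have h2 := integral_besselKernel_mul_gaussian hγ hs y z
  rw [show 1 / (4 * (1 / (4 * b))) = b by field_simp] at h2
  have h3 := gaussianMass_mul_gaussianMass γ hb
  have h4 := gaussianMass_pos hγ hb
  rw [← h3]
  have h5 : gaussianMass γ (1 / (4 * b)) * gaussianMass γ b *
      ((gaussianMass γ b)⁻¹ * heatKernel γ b y z) =
      gaussianMass γ (1 / (4 * b)) * heatKernel γ b y z := by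
    field_simp
  rw [h5, ← h2]
  refine integral_congr_ae (ae_of_all _ fun x => ?_)
  simp only [besselKernel_comm z x]
  ring

/-- The normalizing factor grows only like a power of `b`, so exponential decay away from the
diagonal wins. -/
theorem tendsto_gaussianMass_inv_mul_exp (γ : Fin n → ℝ) {δ : ℝ} (hδ : 0 < δ) :
    Filter.Tendsto (fun b => (gaussianMass γ b)⁻¹ * Real.exp (-δ * b)) Filter.atTop (𝓝 0) := by
  have h := (tendsto_rpow_mul_exp_neg_mul_atTop_nhds_zero (∑ i, (γ i + 1) / 2) δ hδ).const_mul
    (gaussianMass γ 1)⁻¹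
  rw [mul_zero] at h
  refine h.congr' ?_
  filter_upwards [Filter.eventually_gt_atTop 0] with b hb
  rw [inv_gaussianMass γ hb, mul_assoc]

theorem integrable_exp_neg_norm_sub_sq (hγ : ∀ i, 0 < γ i) (y : EuclideanSpace ℝ (Fin n)) :
    Integrable (fun z => Real.exp (-1 * ‖z - y‖ ^ 2)) (orthantMeasure γ) := by
  refine ((integrable_gaussian_orthant hγ (half_pos one_pos)).const_mul
    (Real.exp (‖y‖ ^ 2))).mono' (Continuous.aestronglyMeasurable (by fun_prop))
    (ae_of_all _ fun z => ?_)
  rw [Real.norm_of_nonneg (Real.exp_pos _).le, ← Real.exp_add, Real.exp_le_exp]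
  have h1 : ‖z‖ ≤ ‖z - y‖ + ‖y‖ := by simpa using norm_add_le (z - y) y
  have h2 : ‖z‖ ^ 2 ≤ (‖z - y‖ + ‖y‖) ^ 2 := pow_le_pow_left₀ (norm_nonneg _) h1 2
  nlinarith [sq_nonneg (‖z - y‖ - ‖y‖)]

/-- Chebyshev's inequality: the integrable Gaussian centred at `y` is at least `exp(-r²)` on the
ball. -/
theorem orthantMeasure_ball_lt_top (hγ : ∀ i, 0 < γ i) (y : EuclideanSpace ℝ (Fin n)) (r : ℝ) :
    orthantMeasure γ (Metric.ball y r) < ⊤ := by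
  refine (measure_mono fun z hz => ?_).trans_lt
    ((integrable_exp_neg_norm_sub_sq hγ y).measure_ge_lt_top (Real.exp_pos (-r ^ 2)))
  rw [mem_ball_iff_norm] at hz
  change Real.exp _ ≤ Real.exp _
  rw [Real.exp_le_exp]
  have := pow_le_pow_left₀ (norm_nonneg _) hz.le 2
  linarith

/-- The heat kernel is an approximate identity. -/
theorem tendsto_integral_heatKernel (hγ : ∀ i, 0 < γ i)
    {F : EuclideanSpace ℝ (Fin n) → ℂ} (hFc : ContinuousOn F (orthant n))
    (hF : Integrable F (orthantMeasure γ)) {y : EuclideanSpace ℝ (Fin n)} (hy : y ∈ orthant n) :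
    Filter.Tendsto (fun b => ∫ z, ((gaussianMass γ b)⁻¹ * heatKernel γ b y z) • F z
      ∂orthantMeasure γ) Filter.atTop (𝓝 (F y)) := by
  have hrestr : (orthantMeasure γ).restrict (orthant n) = orthantMeasure γ :=
    Measure.restrict_eq_self_of_ae_mem (ae_orthantMeasure γ)
  have hO := measurableSet_orthant n
  have hbound : ∀ δ : ℝ, 0 < δ → ∀ b : ℝ, 0 < b → ∀ z ∈ orthant n, δ ≤ ‖z - y‖ →
      (gaussianMass γ b)⁻¹ * heatKernel γ b y z ≤
        (gaussianMass γ b)⁻¹ * Real.exp (-(δ ^ 2) * b) := by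
    intro δ hδ b hb z hz hzy
    have := gaussianMass_pos hγ hb
    refine mul_le_mul_of_nonneg_left ((heatKernel_le hγ hb hy hz).trans ?_) (by positivity)
    rw [Real.exp_le_exp]
    nlinarith [pow_le_pow_left₀ hδ.le hzy 2]
  have htail : Filter.Tendsto (fun b => ∫ z in (orthant n ∩ Metric.ball y 1)ᶜ,
      (gaussianMass γ b)⁻¹ * heatKernel γ b y z ∂orthantMeasure γ) Filter.atTop (𝓝 0) := by
    have h1 := (tendsto_gaussianMass_inv_mul_exp γ one_pos).const_mul
      (Real.exp 1 * ∫ z, Real.exp (-1 * ‖z - y‖ ^ 2) ∂orthantMeasure γ)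
    rw [mul_zero] at h1
    refine tendsto_of_tendsto_of_tendsto_of_le_of_le' tendsto_const_nhds h1 ?_ ?_
    · filter_upwards [Filter.eventually_gt_atTop 0] with b hb
      have := gaussianMass_pos hγ hb
      exact integral_nonneg fun z => mul_nonneg (by positivity) (heatKernel_nonneg _ _ _ _)
    · filter_upwards [Filter.eventually_gt_atTop 1] with b hb
      have hb0 : 0 < b := by linarith
      have hm := gaussianMass_pos hγ hb0
      -- For `b > 1` and `|z - y| ≥ 1` one has `b |z-y|² ≥ (b - 1) + |z-y|²`: the first part gives
      -- decay in `b`, the second an integrable majorant.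
      have hle : ∀ᵐ z ∂(orthantMeasure γ).restrict (orthant n ∩ Metric.ball y 1)ᶜ,
          (gaussianMass γ b)⁻¹ * heatKernel γ b y z ≤
            (gaussianMass γ b)⁻¹ * Real.exp (-1 * b) * Real.exp 1 *
              Real.exp (-1 * ‖z - y‖ ^ 2) := by
        filter_upwards [ae_restrict_mem (hO.inter measurableSet_ball).compl,
          ae_restrict_of_ae (ae_orthantMeasure γ)] with z hz hzO
        have hz1 : 1 ≤ ‖z - y‖ := by
          by_contra hlt
          exact hz ⟨hzO, by rw [mem_ball_iff_norm]; linarith⟩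
        rw [mul_assoc, mul_assoc, ← Real.exp_add, ← Real.exp_add]
        refine mul_le_mul_of_nonneg_left ((heatKernel_le hγ hb0 hy hzO).trans ?_) (by positivity)
        rw [Real.exp_le_exp]
        nlinarith [pow_le_pow_left₀ zero_le_one hz1 2]
      have hi := (integrable_exp_neg_norm_sub_sq hγ y).const_mul
        ((gaussianMass γ b)⁻¹ * Real.exp (-1 * b) * Real.exp 1)
      calc _ ≤ ∫ z in (orthant n ∩ Metric.ball y 1)ᶜ, (gaussianMass γ b)⁻¹ * Real.exp (-1 * b) *
              Real.exp 1 * Real.exp (-1 * ‖z - y‖ ^ 2) ∂orthantMeasure γ :=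
            integral_mono_of_nonneg (ae_of_all _ fun z => mul_nonneg (by positivity)
              (heatKernel_nonneg _ _ _ _)) hi.integrableOn hle
        _ ≤ ∫ z, (gaussianMass γ b)⁻¹ * Real.exp (-1 * b) *
              Real.exp 1 * Real.exp (-1 * ‖z - y‖ ^ 2) ∂orthantMeasure γ :=
            setIntegral_le_integral hi (ae_of_all _ fun z => by positivity)
        _ = _ := by
            rw [integral_const_mul]
            ring
  have key := tendsto_setIntegral_peak_smul_of_integrableOn_of_tendsto
    (μ := orthantMeasure γ) (l := Filter.atTop) (s := orthant n) (x₀ := y)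
    (φ := fun b z => (gaussianMass γ b)⁻¹ * heatKernel γ b y z) (g := F) (a := F y)
    hO (t := orthant n ∩ Metric.ball y 1) (hO.inter measurableSet_ball) inter_subset_left
    (Filter.inter_mem self_mem_nhdsWithin (mem_nhdsWithin_of_mem_nhds (Metric.ball_mem_nhds y one_pos)))
    ((measure_mono inter_subset_right).trans_lt (orthantMeasure_ball_lt_top hγ y 1)).ne ?_ ?_ ?_ ?_
    hF.integrableOn (hFc y hy)
  · simpa only [hrestr] using key
  · filter_upwards [Filter.eventually_gt_atTop 0] with b hb z _
    have := gaussianMass_pos hγ hb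
    exact mul_nonneg (by positivity) (heatKernel_nonneg _ _ _ _)
  · intro u hu hyu
    obtain ⟨δ, hδ, hball⟩ := Metric.isOpen_iff.1 hu y hyu
    rw [Metric.tendstoUniformlyOn_iff]
    intro ε hε
    filter_upwards [(tendsto_gaussianMass_inv_mul_exp γ (pow_pos hδ 2)).eventually_lt_const hε,
      Filter.eventually_gt_atTop 0] with b hb hb0 z hz
    have hm := gaussianMass_pos hγ hb0
    have hzy : δ ≤ ‖z - y‖ := by
      by_contra hlt
      exact hz.2 (hball (by rw [mem_ball_iff_norm]; linarith))
    rw [Pi.zero_apply, dist_zero_left, Real.norm_of_nonneg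
      (mul_nonneg (by positivity) (heatKernel_nonneg _ _ _ _))]
    exact (hbound δ hδ b hb0 z hz.1 hzy).trans_lt hb
  -- The normalized kernel has total mass one, so its mass near `y` is one minus the vanishing tail.
  · have h1 := tendsto_const_nhds (x := (1 : ℝ)) |>.sub htail
    rw [sub_zero] at h1
    refine h1.congr' ?_
    filter_upwards [Filter.eventually_gt_atTop 0] with b hb
    have hm := gaussianMass_pos hγ hb
    have hi : Integrable (fun z => (gaussianMass γ b)⁻¹ * heatKernel γ b y z)
        (orthantMeasure γ) := by
      refine Integrable.const_mul (Integrable.of_integral_ne_zero ?_) _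
      rw [integral_heatKernel hγ hb]
      exact hm.ne'
    have h2 := integral_add_compl (hO.inter (measurableSet_ball (x := y) (ε := 1))) hi
    rw [integral_const_mul (μ := orthantMeasure γ), integral_heatKernel hγ hb,
      inv_mul_cancel₀ hm.ne'] at h2
    linarith
  · filter_upwards [Filter.eventually_gt_atTop 0] with b hb
    exact ((continuous_heatKernel hγ hb y).const_mul _).aestronglyMeasurable

theorem tendsto_integral_gaussian_smul {μ : Measure (EuclideanSpace ℝ (Fin n))}
    {g : EuclideanSpace ℝ (Fin n) → ℂ} (hg : Integrable g μ) :
    Filter.Tendsto (fun b : ℝ => ∫ x, Real.exp (-(1 / (4 * b)) * ‖x‖ ^ 2) • g x ∂μ) Filter.atTop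
      (𝓝 (∫ x, g x ∂μ)) := by
  refine tendsto_integral_filter_of_dominated_convergence (fun x => ‖g x‖)
    (Filter.Eventually.of_forall fun b => ?_) ?_ hg.norm (ae_of_all _ fun x => ?_)
  · have hc : Continuous fun x : EuclideanSpace ℝ (Fin n) =>
      Real.exp (-(1 / (4 * b)) * ‖x‖ ^ 2) := by fun_prop
    exact hc.aestronglyMeasurable.smul hg.aestronglyMeasurable
  · filter_upwards [Filter.eventually_gt_atTop 0] with b hb
    refine ae_of_all _ fun x => ?_
    rw [norm_smul, Real.norm_of_nonneg (Real.exp_pos _).le]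
    refine mul_le_of_le_one_left (norm_nonneg _) (Real.exp_le_one_iff.2 ?_)
    rw [neg_mul, neg_nonpos]
    positivity
  · have h2 : Filter.Tendsto (fun b : ℝ => 1 / (4 * b)) Filter.atTop (𝓝 0) :=
      Filter.Tendsto.div_atTop tendsto_const_nhds
        (Filter.tendsto_id.const_mul_atTop (by norm_num))
    have h3 : Filter.Tendsto (fun b : ℝ => Real.exp (-(1 / (4 * b)) * ‖x‖ ^ 2)) Filter.atTop
        (𝓝 (Real.exp (-0 * ‖x‖ ^ 2))) :=
      (Real.continuous_exp.tendsto _).comp (h2.neg.mul_const _)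
    simpa using h3.smul_const (g x)

theorem integrable_besselKernel_smul (hγ : ∀ i, 0 < γ i)
    {μ : Measure (EuclideanSpace ℝ (Fin n))} {G : EuclideanSpace ℝ (Fin n) → ℂ}
    (hG : Integrable G μ) (y : EuclideanSpace ℝ (Fin n)) :
    Integrable (fun x => besselKernel γ x y • G x) μ :=
  hG.mono ((continuous_besselKernel_left hγ y).aestronglyMeasurable.smul hG.aestronglyMeasurable)
    (ae_of_all _ fun _ => norm_besselKernel_smul_le hγ _ _ _)

/-- The inversion formula. -/
theorem integral_besselKernel_smul_fourierBessel (hγ : ∀ i, 0 < γ i)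
    {F : EuclideanSpace ℝ (Fin n) → ℂ} (hFc : ContinuousOn F (orthant n))
    (hF : Integrable F (orthantMeasure γ))
    (hG : Integrable (fourierBessel γ F) (orthantMeasure γ))
    {y : EuclideanSpace ℝ (Fin n)} (hy : y ∈ orthant n) :
    ∫ x, besselKernel γ x y • fourierBessel γ F x ∂orthantMeasure γ =
      (2 ^ (∑ i, γ i - n) * (∏ i, Real.Gamma ((γ i + 1) / 2)) ^ 2) • F y := by
  have h1 := (tendsto_integral_heatKernel hγ hFc hF hy).const_smul
    (2 ^ (∑ i, γ i - n) * (∏ i, Real.Gamma ((γ i + 1) / 2)) ^ 2)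
  refine tendsto_nhds_unique
    (tendsto_integral_gaussian_smul (integrable_besselKernel_smul hγ hG y)) (h1.congr' ?_)
  filter_upwards [Filter.eventually_gt_atTop 0] with b hb
  rw [← integral_fourierBessel_gaussian hγ hF hb y]
  simp only [smul_smul, mul_comm]

end Inversion

/-! ### Uniqueness of finite measures with given Fourier–Bessel transform -/

/-- Integrate the transform over `η` against a Gaussian with coefficients `1/(4 t_i)`. By Fubini and
Weber's first integral the result is a positive constant times the integral of `exp(-∑ t_i x_i²)`,
so equal transforms give equal Gaussian integrals. Concentration on the orthant is needed because
the kernel is even in each coordinate. -/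
theorem ext_of_integral_besselKernel {n : ℕ} {γ : Fin n → ℝ} (hγ : ∀ i, 0 < γ i)
    {μ ν : Measure (EuclideanSpace ℝ (Fin n))} [IsFiniteMeasure μ] [IsFiniteMeasure ν]
    (hμ : ∀ᵐ x ∂μ, x ∈ orthant n) (hν : ∀ᵐ x ∂ν, x ∈ orthant n)
    (h : ∀ η, ∫ x, besselKernel γ x η ∂μ = ∫ x, besselKernel γ x η ∂ν) : μ = ν := by
  have hq : ∀ {ρ : Measure (EuclideanSpace ℝ (Fin n))}, (∀ᵐ x ∂ρ, x ∈ orthant n) →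
      ∀ᵐ x ∂ρ, WithLp.toLp 2 (fun i => ((Real.toNNReal (x i) : NNReal) : ℝ)) = x := by
    intro ρ hρ
    filter_upwards [hρ] with x hx
    ext i
    exact Real.coe_toNNReal _ (hx i).le
  have hc := continuous_besselKernel hγ
  have hgauss : ∀ t : Fin n → ℝ, (∀ i, 0 < t i) → ∀ {ρ : Measure (EuclideanSpace ℝ (Fin n))}
      [IsFiniteMeasure ρ], (∀ᵐ x ∂ρ, x ∈ orthant n) →
      (∏ i, Real.Gamma ((γ i + 1) / 2) / (2 * (1 / (4 * t i)) ^ ((γ i + 1) / 2))) *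
        ∫ x, Real.exp (-∑ i, t i * ((Real.toNNReal (x i) : NNReal) : ℝ) ^ 2) ∂ρ =
      ∫ η, (∫ x, besselKernel γ x η ∂ρ) * ∏ i, Real.exp (-(1 / (4 * t i)) * η i ^ 2)
        ∂orthantMeasure γ := by
    intro t ht ρ _ hρ
    have hs : ∀ i, 0 < 1 / (4 * t i) := fun i => by
      have := ht i
      positivity
    have hg : Integrable (fun η : EuclideanSpace ℝ (Fin n) =>
        ∏ i, Real.exp (-(1 / (4 * t i)) * η i ^ 2)) (orthantMeasure γ) := by
      refine integrable_orthantMeasure_prod γ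
        (f := fun i r => Real.exp (-(1 / (4 * t i)) * r ^ 2)) fun i => ?_
      simpa using integrable_radial_exp (hγ i) (hs i) 0
    have hI : Integrable (fun p : EuclideanSpace ℝ (Fin n) × EuclideanSpace ℝ (Fin n) =>
        besselKernel γ p.1 p.2 * ∏ i, Real.exp (-(1 / (4 * t i)) * p.2 i ^ 2))
        (ρ.prod (orthantMeasure γ)) := by
      refine (hg.comp_snd ρ).mono' (Continuous.aestronglyMeasurable (by fun_prop))
        (ae_of_all _ fun p => ?_)
      have h0 : 0 ≤ ∏ i, Real.exp (-(1 / (4 * t i)) * p.2 i ^ 2) :=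
        Finset.prod_nonneg fun i _ => (Real.exp_pos _).le
      rw [norm_mul, Real.norm_of_nonneg h0]
      exact mul_le_of_le_one_left h0 (abs_besselKernel_le hγ _ _)
    simp only [← integral_mul_const]
    rw [← integral_integral_swap hI, ← integral_const_mul]
    refine integral_congr_ae ?_
    filter_upwards [hρ] with x hx
    have e : ∀ η : EuclideanSpace ℝ (Fin n), besselKernel γ x η *
        ∏ i, Real.exp (-(1 / (4 * t i)) * η i ^ 2) = ∏ i, (smallBessel ((γ i - 1) / 2) (η i * x i) *
          Real.exp (-(1 / (4 * t i)) * η i ^ 2)) := by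
      intro η
      rw [besselKernel, Finset.prod_mul_distrib]
      simp only [mul_comm]
    simp only [e]
    rw [integral_orthantMeasure_prod γ fun i r => smallBessel ((γ i - 1) / 2) (r * x i) *
      Real.exp (-(1 / (4 * t i)) * r ^ 2)]
    simp only [integral_smallBessel_gaussian (hγ _) (hs _)]
    rw [Finset.prod_mul_distrib, ← Finset.sum_neg_distrib, Real.exp_sum]
    congr 1
    refine Finset.prod_congr rfl fun i _ => ?_
    rw [Real.coe_toNNReal _ (hx i).le]
    have := ht i
    congr 1
    field_simp
  refine ext_of_integral_gaussian (q := fun x i => Real.toNNReal (x i))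
    (p := fun u => WithLp.toLp 2 fun i => (u i : ℝ)) (by fun_prop) (by fun_prop) (hq hμ) (hq hν)
    ?_ fun t ht => ?_
  -- The kernel is `1` at `η = 0`, so the transform there is the total mass.
  · have := h 0
    simpa [besselKernel_zero hγ] using this
  · have h1 := hgauss t ht hμ
    have h2 := hgauss t ht hν
    simp only [h] at h1
    rw [← h2] at h1
    refine mul_left_cancel₀ (ne_of_gt (Finset.prod_pos fun i _ => ?_)) h1
    have := Real.Gamma_pos_of_pos (show 0 < (γ i + 1) / 2 by linarith [hγ i])
    have := ht i
    positivity

/-! ### The product of the angle measures -/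

/-- Identifies the multiple angular integral defining the translation with the expectation over
independent angles, so that product functions factorize and Fubini applies. -/
theorem pi_angleMeasure {n : ℕ} {γ : Fin n → ℝ} (hγ : ∀ i, 0 < γ i) :
    Measure.pi (fun i => angleMeasure (γ i)) = (volume.restrict (angleCube n)).withDensity fun φ =>
      ENNReal.ofReal (∏ i, (angleConst (γ i) * Real.sin (φ i) ^ (γ i - 1))) := by
  have := fun i => isProbabilityMeasure_angleMeasure (hγ i)
  refine Measure.pi_eq fun s hs => ?_
  have hr : (volume.restrict (angleCube n)).restrict (univ.pi s) =
      Measure.pi fun i => (volume.restrict (Ioo 0 Real.pi)).restrict (s i) := by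
    rw [angleCube, volume_pi, Measure.restrict_pi_pi, Measure.restrict_pi_pi]
  have hI : ∀ i, Integrable (fun φ => angleConst (γ i) * Real.sin φ ^ (γ i - 1))
      ((volume.restrict (Ioo 0 Real.pi)).restrict (s i)) :=
    fun i => ((integrableOn_sin_rpow (hγ i)).const_mul _).restrict
  have hpos : ∀ i, ∀ᵐ φ ∂(volume.restrict (Ioo 0 Real.pi)).restrict (s i),
      0 ≤ angleConst (γ i) * Real.sin φ ^ (γ i - 1) := fun i => by
    filter_upwards [ae_restrict_of_ae (ae_restrict_mem measurableSet_Ioo)] with φ hφ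
    exact angleDensity_nonneg (hγ i) hφ
  have hae : ∀ᵐ φ ∂(Measure.pi fun i => (volume.restrict (Ioo 0 Real.pi)).restrict (s i)),
      0 ≤ ∏ i, (angleConst (γ i) * Real.sin (φ i) ^ (γ i - 1)) := by
    have h1 : ∀ i, ∀ᵐ φ ∂(Measure.pi fun i => (volume.restrict (Ioo 0 Real.pi)).restrict (s i)),
        0 ≤ angleConst (γ i) * Real.sin (φ i) ^ (γ i - 1) := fun i =>
      (Measure.quasiMeasurePreserving_eval
        (fun i => (volume.restrict (Ioo 0 Real.pi)).restrict (s i)) i).ae (hpos i)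
    filter_upwards [ae_all_iff.2 h1] with φ hφ
    exact Finset.prod_nonneg fun i _ => hφ i
  rw [withDensity_apply _ (MeasurableSet.univ_pi hs), hr, ← ofReal_integral_eq_lintegral_ofReal
    (Integrable.fintype_prod (f := fun i φ => angleConst (γ i) * Real.sin φ ^ (γ i - 1)) hI) hae,
    integral_fintype_prod_eq_prod (fun i φ => angleConst (γ i) * Real.sin φ ^ (γ i - 1)),
    ENNReal.ofReal_prod_of_nonneg fun i _ => integral_nonneg_of_ae (hpos i)]
  refine Finset.prod_congr rfl fun i _ => ?_
  rw [ofReal_integral_eq_lintegral_ofReal (hI i) (hpos i), angleMeasure,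
    withDensity_apply _ (hs i)]

section Translation

variable {n : ℕ} {γ : Fin n → ℝ}

theorem measurableSet_angleCube (n : ℕ) : MeasurableSet (angleCube n) :=
  MeasurableSet.univ_pi fun _ => measurableSet_Ioo

theorem angleDensity_toReal_smul (hγ : ∀ i, 0 < γ i) (f : EuclideanSpace ℝ (Fin n) → ℂ)
    (y x : EuclideanSpace ℝ (Fin n)) {φ : Fin n → ℝ} (hφ : φ ∈ angleCube n) :
    (ENNReal.ofReal (∏ i, (angleConst (γ i) * Real.sin (φ i) ^ (γ i - 1)))).toReal •
        f (translationPoint x y φ) =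
      (∏ i, angleConst (γ i)) • translationIntegrand γ f y x φ := by
  rw [ENNReal.toReal_ofReal (Finset.prod_nonneg fun i _ =>
    angleDensity_nonneg (hγ i) (hφ i trivial)), Finset.prod_mul_distrib, mul_smul,
    translationIntegrand, Complex.real_smul (x := ∏ i, Real.sin (φ i) ^ (γ i - 1))]

theorem translation_eq (hγ : ∀ i, 0 < γ i) (f : EuclideanSpace ℝ (Fin n) → ℂ)
    (y x : EuclideanSpace ℝ (Fin n)) :
    translation γ f y x =
      ∫ φ, f (translationPoint x y φ) ∂Measure.pi fun i => angleMeasure (γ i) := by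
  rw [pi_angleMeasure hγ, integral_withDensity_eq_integral_toReal_smul (by fun_prop) (by simp),
    setIntegral_congr_fun (measurableSet_angleCube n) fun φ hφ =>
      angleDensity_toReal_smul hγ f y x hφ, integral_smul, Complex.real_smul]
  rfl

theorem integrableOn_translationIntegrand (hγ : ∀ i, 0 < γ i)
    {f : EuclideanSpace ℝ (Fin n) → ℂ} {y x : EuclideanSpace ℝ (Fin n)}
    (h : Integrable (fun φ => f (translationPoint x y φ))
      (Measure.pi fun i => angleMeasure (γ i))) :
    IntegrableOn (translationIntegrand γ f y x) (angleCube n) := by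
  rw [pi_angleMeasure hγ, integrable_withDensity_iff_integrable_smul' (by fun_prop) (by simp)] at h
  have h' : IntegrableOn (fun φ => (∏ i, angleConst (γ i)) • translationIntegrand γ f y x φ)
      (angleCube n) := (integrableOn_congr_fun (fun φ hφ => angleDensity_toReal_smul hγ f y x hφ)
    (measurableSet_angleCube n)).1 h
  exact (integrable_fun_smul_iff (Finset.prod_pos fun i _ => angleConst_pos (hγ i)).ne' _).1 h'

theorem continuous_translationPoint : Continuous
    fun p : (EuclideanSpace ℝ (Fin n) × EuclideanSpace ℝ (Fin n)) × (Fin n → ℝ) =>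
      translationPoint p.1.1 p.1.2 p.2 := by
  unfold translationPoint
  fun_prop

theorem translationPoint_mem_orthant {x y : EuclideanSpace ℝ (Fin n)} (hx : x ∈ orthant n)
    (hy : y ∈ orthant n) {φ : Fin n → ℝ} (hφ : φ ∈ angleCube n) :
    translationPoint x y φ ∈ orthant n := by
  intro i
  refine Real.sqrt_pos.2 ?_
  have h1 : Real.cos (φ i) < 1 := by
    have := Real.cos_lt_cos_of_nonneg_of_le_pi le_rfl (hφ i trivial).2.le (hφ i trivial).1
    rwa [Real.cos_zero] at this
  nlinarith [mul_pos (mul_pos (hx i) (hy i)) (sub_pos.2 h1), sq_nonneg (x i - y i)]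

theorem ae_pi_angleMeasure (hγ : ∀ i, 0 < γ i) :
    ∀ᵐ φ ∂Measure.pi fun i => angleMeasure (γ i), φ ∈ angleCube n := by
  rw [pi_angleMeasure hγ]
  exact (withDensity_absolutelyContinuous _ _).ae_le (ae_restrict_mem (measurableSet_angleCube n))

/-- Translated Bessel kernels are products of Bessel kernels. -/
theorem integral_besselKernel_translationPoint (hγ : ∀ i, 0 < γ i)
    (x y η : EuclideanSpace ℝ (Fin n)) :
    ∫ φ, besselKernel γ (translationPoint x y φ) η ∂Measure.pi (fun i => angleMeasure (γ i)) =
      besselKernel γ x η * besselKernel γ y η := by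
  have := fun i => isProbabilityMeasure_angleMeasure (hγ i)
  simp only [besselKernel, translationPoint]
  rw [integral_fintype_prod_eq_prod fun i φ =>
    smallBessel ((γ i - 1) / 2) (√(x i ^ 2 + y i ^ 2 - 2 * x i * y i * Real.cos φ) * η i)]
  simp only [integral_smallBessel_chord (hγ _), Finset.prod_mul_distrib]

end Translation

/-! ### The law of the translation of two points on the sphere -/

section Spheres

variable {n : ℕ} {γ : Fin n → ℝ}

/-- The chord of the circle of radius `lam` seen under the angle `φ`. -/
def chord (lam φ : ℝ) : ℝ := √(lam ^ 2 + lam ^ 2 - 2 * lam * lam * Real.cos φ)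

theorem chord_eq {lam φ : ℝ} (hlam : 0 < lam) (hφ : φ ∈ Ioo 0 Real.pi) :
    chord lam φ = 2 * lam * Real.sin (φ / 2) := by
  have h0 : 0 ≤ Real.sin (φ / 2) :=
    Real.sin_nonneg_of_nonneg_of_le_pi (by linarith [hφ.1]) (by linarith [hφ.2, Real.pi_pos])
  have h1 : Real.cos φ = 2 * Real.cos (φ / 2) ^ 2 - 1 := by
    rw [← Real.cos_two_mul]
    ring_nf
  rw [chord, h1, show lam ^ 2 + lam ^ 2 - 2 * lam * lam * (2 * Real.cos (φ / 2) ^ 2 - 1) =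
    (2 * lam * Real.sin (φ / 2)) ^ 2 by
      linear_combination (-(4 * lam ^ 2)) * Real.sin_sq_add_cos_sq (φ / 2),
    Real.sqrt_sq (by positivity)]

theorem continuous_chord (lam : ℝ) : Continuous (chord lam) := by
  unfold chord
  fun_prop

/-- The constant in the density of the chord length. -/
def chordConst (p lam : ℝ) : ℝ := angleConst p * 2 ^ (2 - p) * lam ^ (2 - 2 * p)

/-- The density of the law of the chord length with respect to `r ^ p dr`. -/
def chordDensity (p lam r : ℝ) : ℝ :=
  (Iio (2 * lam)).indicator
    (fun r => chordConst p lam * (r⁻¹ * (4 * lam ^ 2 - r ^ 2) ^ ((p - 2) / 2))) r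

theorem chordConst_pos {p lam : ℝ} (hp : 0 < p) (hlam : 0 < lam) : 0 < chordConst p lam := by
  have := angleConst_pos hp
  unfold chordConst
  positivity

theorem measurable_chordDensity (p lam : ℝ) : Measurable (chordDensity p lam) :=
  Measurable.indicator (by fun_prop) measurableSet_Iio

theorem chordDensity_nonneg {p lam r : ℝ} (hp : 0 < p) (hlam : 0 < lam) (hr : 0 < r) :
    0 ≤ chordDensity p lam r := by
  refine indicator_apply_nonneg fun h => ?_
  have h' : r < 2 * lam := h
  have : 0 ≤ 4 * lam ^ 2 - r ^ 2 := by nlinarith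
  have := chordConst_pos hp hlam
  positivity

theorem image_chord {lam : ℝ} (hlam : 0 < lam) :
    (fun φ => 2 * lam * Real.sin (φ / 2)) '' Ioo 0 Real.pi = Ioo 0 (2 * lam) := by
  ext r
  constructor
  · rintro ⟨φ, hφ, rfl⟩
    have h0 : 0 < Real.sin (φ / 2) :=
      Real.sin_pos_of_pos_of_lt_pi (by linarith [hφ.1]) (by linarith [hφ.2, Real.pi_pos])
    have h1 : Real.sin (φ / 2) < 1 := by
      have := Real.sin_lt_sin_of_lt_of_le_pi_div_two (x := φ / 2) (y := Real.pi / 2)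
        (by linarith [hφ.1, Real.pi_pos]) le_rfl (by linarith [hφ.2])
      rwa [Real.sin_pi_div_two] at this
    constructor
    · simp only
      positivity
    · simp only
      nlinarith
  · rintro ⟨h0, h1⟩
    have h2 : 0 < r / (2 * lam) := by positivity
    have h3 : r / (2 * lam) < 1 := (div_lt_one (by positivity)).2 h1
    refine ⟨2 * Real.arcsin (r / (2 * lam)), ⟨?_, ?_⟩, ?_⟩
    · have := Real.arcsin_pos.2 h2
      linarith
    · have := Real.arcsin_lt_pi_div_two.2 h3
      linarith
    · simp only
      rw [mul_div_cancel_left₀ _ two_ne_zero, Real.sin_arcsin (by linarith) h3.le]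
      field_simp

/-- The law of the chord length. -/
theorem lintegral_chord (p : ℝ) {lam : ℝ} (hlam : 0 < lam) {g : ℝ → ENNReal}
    (hg : Measurable g) :
    ∫⁻ φ, g (chord lam φ) ∂angleMeasure p =
      ∫⁻ r, ENNReal.ofReal (chordDensity p lam r) * g r ∂radialMeasure p := by
  have hD := measurable_chordDensity p lam
  have hc := continuous_chord lam
  have hgc : Measurable fun φ => g (chord lam φ) := hg.comp hc.measurable
  have hDg : Measurable fun r => ENNReal.ofReal (chordDensity p lam r) * g r :=
    hD.ennreal_ofReal.mul hg
  have hderiv : ∀ φ ∈ Ioo 0 Real.pi, HasDerivWithinAt (fun φ => 2 * lam * Real.sin (φ / 2))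
      (lam * Real.cos (φ / 2)) (Ioo 0 Real.pi) φ := by
    intro φ _
    have h := (((hasDerivAt_id φ).div_const 2).sin).const_mul (2 * lam)
    refine (h.congr_deriv ?_).hasDerivWithinAt
    simp only [id]
    ring
  have hinj : InjOn (fun φ => 2 * lam * Real.sin (φ / 2)) (Ioo 0 Real.pi) := by
    intro φ hφ φ' hφ' h
    have h1 := mul_left_cancel₀ (by positivity) h
    have := Real.injOn_sin ⟨by linarith [hφ.1, Real.pi_pos], by linarith [hφ.2]⟩
      ⟨by linarith [hφ'.1, Real.pi_pos], by linarith [hφ'.2]⟩ h1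
    linarith
  have h1 : ∫⁻ r, ENNReal.ofReal (chordDensity p lam r) * g r ∂radialMeasure p =
      ∫⁻ r in Ioo 0 (2 * lam), ENNReal.ofReal (r ^ p * chordDensity p lam r) * g r := by
    rw [radialMeasure, lintegral_withDensity_eq_lintegral_mul _ (by fun_prop)
      hDg, ← Iio_inter_Ioi, ← Measure.restrict_restrict measurableSet_Iio,
      ← lintegral_indicator measurableSet_Iio]
    refine setLIntegral_congr_fun measurableSet_Ioi fun r hr => ?_
    simp only [Pi.mul_apply]
    by_cases hr2 : r ∈ Iio (2 * lam)
    · rw [indicator_of_mem hr2, ENNReal.ofReal_mul (Real.rpow_nonneg (le_of_lt hr) _), mul_assoc]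
    · rw [indicator_of_notMem hr2, chordDensity, indicator_of_notMem hr2]
      simp
  rw [h1, ← image_chord hlam, lintegral_image_eq_lintegral_abs_deriv_mul measurableSet_Ioo hderiv
    hinj, angleMeasure, lintegral_withDensity_eq_lintegral_mul _ (by fun_prop) hgc]
  refine setLIntegral_congr_fun measurableSet_Ioo fun φ hφ => ?_
  have hs : 0 < Real.sin (φ / 2) :=
    Real.sin_pos_of_pos_of_lt_pi (by linarith [hφ.1]) (by linarith [hφ.2, Real.pi_pos])
  have hco : 0 < Real.cos (φ / 2) := Real.cos_pos_of_mem_Ioo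
    ⟨by linarith [hφ.1, Real.pi_pos], by linarith [hφ.2]⟩
  have hmem : 2 * lam * Real.sin (φ / 2) ∈ Ioo 0 (2 * lam) := by
    rw [← image_chord hlam]
    exact ⟨φ, hφ, rfl⟩
  simp only [Pi.mul_apply]
  rw [chord_eq hlam hφ, chordDensity, indicator_of_mem (show _ ∈ Iio (2 * lam) from hmem.2), ← mul_assoc, abs_of_pos
    (by positivity), ← ENNReal.ofReal_mul (by positivity)]
  congr 2
  -- With `r = 2λ sin(φ/2)` one has `4λ² - r² = (2λ cos(φ/2))²`. Every power then reduces to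
  -- exponent `p - 1`, and once the powers are abstracted only `e5` and `e6` are needed to compare
  -- constants.
  have e1 : Real.sin φ = 2 * Real.sin (φ / 2) * Real.cos (φ / 2) := by
    rw [← Real.sin_two_mul]
    ring_nf
  have e2 : (4 * lam ^ 2 - (2 * lam * Real.sin (φ / 2)) ^ 2) ^ ((p - 2) / 2) =
      (2 * lam * Real.cos (φ / 2)) ^ (p - 2) := by
    rw [show 4 * lam ^ 2 - (2 * lam * Real.sin (φ / 2)) ^ 2 = (2 * lam * Real.cos (φ / 2)) ^ 2 by
      linear_combination (-(4 * lam ^ 2)) * Real.sin_sq_add_cos_sq (φ / 2), ← Real.rpow_two,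
      ← Real.rpow_mul (by positivity)]
    ring_nf
  generalize Real.sin (φ / 2) = s at *
  generalize Real.cos (φ / 2) = c at *
  have e3 : ∀ x : ℝ, 0 < x → x ^ p = x ^ (p - 1) * x := fun x hx => by
    rw [Real.rpow_sub_one hx.ne']
    field_simp
  have e4 : (2 * lam * c) ^ (p - 2) = (2 * lam * c) ^ (p - 1) * (2 * lam * c)⁻¹ := by
    rw [show p - 2 = p - 1 - 1 by ring, Real.rpow_sub_one (by positivity), div_eq_mul_inv]
  have e5 : (2 : ℝ) ^ (2 - p) * 2 ^ (p - 1) = 2 := by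
    rw [← Real.rpow_add two_pos]
    norm_num
  have e6 : lam ^ (2 - 2 * p) * (lam ^ (p - 1) * lam ^ (p - 1)) = 1 := by
    rw [← Real.rpow_add hlam, ← Real.rpow_add hlam]
    ring_nf
    exact Real.rpow_zero _
  rw [e2, e4, e3 _ (by positivity), e1, chordConst, Real.mul_rpow (by positivity) hco.le,
    Real.mul_rpow two_pos.le hs.le, Real.mul_rpow (by positivity) hs.le,
    Real.mul_rpow (by positivity) hco.le, Real.mul_rpow two_pos.le hlam.le]
  generalize lam ^ (2 - 2 * p) = L at *
  generalize lam ^ (p - 1) = M at *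
  generalize (2 : ℝ) ^ (2 - p) = A at *
  generalize (2 : ℝ) ^ (p - 1) = B at *
  field_simp
  linear_combination (-angleConst p * B) * (e5 * L * M ^ 2 + 2 * e6)

/-- The measure `ζ ^ γ ξ ^ γ dS(ζ) dS(ξ)` times the normalized measure on the angles. -/
def sphereAngleMeasure (γ : Fin n → ℝ) : Measure ((Metric.sphere (0 : EuclideanSpace ℝ (Fin n)) 1 ×
    Metric.sphere (0 : EuclideanSpace ℝ (Fin n)) 1) × (Fin n → ℝ)) :=
  ((weightedSphere γ).prod (weightedSphere γ)).prod (Measure.pi fun i => angleMeasure (γ i))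

/-- The argument of the function translated by `lam • ζ` and evaluated at `lam • ξ`. -/
def sphereTranslationPoint (lam : ℝ) (q : (Metric.sphere (0 : EuclideanSpace ℝ (Fin n)) 1 ×
    Metric.sphere (0 : EuclideanSpace ℝ (Fin n)) 1) × (Fin n → ℝ)) : EuclideanSpace ℝ (Fin n) :=
  translationPoint (lam • q.1.2.1) (lam • q.1.1.1) q.2

theorem measurable_sphereTranslationPoint (lam : ℝ) :
    Measurable (sphereTranslationPoint (n := n) lam) :=
  Continuous.measurable (continuous_translationPoint.comp
    (f := fun q : (Metric.sphere (0 : EuclideanSpace ℝ (Fin n)) 1 ×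
      Metric.sphere (0 : EuclideanSpace ℝ (Fin n)) 1) × (Fin n → ℝ) =>
        ((lam • q.1.2.1, lam • q.1.1.1), q.2)) (by fun_prop))

/-- A random length times an independent direction: in polar coordinates for `x^γ dx`, a density
relative to `r^p dr` becomes the same density evaluated at `|x|`. -/
theorem map_chord_smul (hn : 0 < n) (hγ : ∀ i, 0 < γ i) {lam : ℝ} (hlam : 0 < lam) :
    ((angleMeasure (polarExponent γ)).prod (weightedSphere γ)).map
        (fun q => chord lam q.1 • q.2.1) =
      (orthantMeasure γ).withDensity
        fun x => ENNReal.ofReal (chordDensity (polarExponent γ) lam ‖x‖) := by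
  have hp := polarExponent_pos hn hγ
  have := isFiniteMeasure_weightedSphere hγ
  have := isProbabilityMeasure_angleMeasure hp
  have hD := measurable_chordDensity (polarExponent γ) lam
  have hc := continuous_chord lam
  refine Measure.ext_of_lintegral _ fun g hg => ?_
  have hm : Measurable fun q : ℝ × Metric.sphere (0 : EuclideanSpace ℝ (Fin n)) 1 =>
      chord lam q.1 • q.2.1 := by fun_prop
  rw [lintegral_map hg hm, lintegral_prod_symm
    (fun q : ℝ × Metric.sphere (0 : EuclideanSpace ℝ (Fin n)) 1 => g (chord lam q.1 • q.2.1))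
      (hg.comp hm).aemeasurable,
    lintegral_withDensity_eq_lintegral_mul _ (by fun_prop) hg,
    lintegral_orthantMeasure hn γ (by fun_prop)]
  refine lintegral_congr fun θ => ?_
  simp only [Pi.mul_apply]
  rw [lintegral_chord _ hlam (g := fun r => g (r • θ.1)) (by fun_prop)]
  refine lintegral_congr_ae ?_
  filter_upwards [ae_radialMeasure (polarExponent γ)] with r hr
  have hθ : ‖θ.1‖ = 1 := by simp
  rw [norm_smul, hθ, mul_one, Real.norm_of_nonneg hr.le]

theorem ae_sphereAngleMeasure (hγ : ∀ i, 0 < γ i) {lam : ℝ} (hlam : 0 < lam) :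
    ∀ᵐ q ∂sphereAngleMeasure γ, sphereTranslationPoint lam q ∈ orthant n := by
  have := isFiniteMeasure_weightedSphere hγ
  have := fun i => isProbabilityMeasure_angleMeasure (hγ i)
  unfold sphereAngleMeasure
  filter_upwards [Measure.quasiMeasurePreserving_fst.ae
      (Measure.quasiMeasurePreserving_fst.ae (ae_weightedSphere γ)),
    Measure.quasiMeasurePreserving_fst.ae
      (Measure.quasiMeasurePreserving_snd.ae (ae_weightedSphere γ)),
    Measure.quasiMeasurePreserving_snd.ae (ae_pi_angleMeasure hγ)] with q h1 h2 h3
  exact translationPoint_mem_orthant ((smul_mem_orthant_iff hlam).2 h2)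
    ((smul_mem_orthant_iff hlam).2 h1) h3

/-- The law of the translated point has an isotropic density. -/
theorem map_sphereTranslationPoint (hn : 0 < n) (hγ : ∀ i, 0 < γ i) {lam : ℝ} (hlam : 0 < lam) :
    (sphereAngleMeasure γ).map (sphereTranslationPoint lam) =
      ENNReal.ofReal (sphereArea γ) • (orthantMeasure γ).withDensity
        fun x => ENNReal.ofReal (chordDensity (polarExponent γ) lam ‖x‖) := by
  have hp := polarExponent_pos hn hγ
  have := isFiniteMeasure_weightedSphere hγ
  have := isProbabilityMeasure_angleMeasure hp
  have := fun i => isProbabilityMeasure_angleMeasure (hγ i)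
  have hA : 0 ≤ sphereArea γ := by
    rw [← weightedSphere_real_univ]
    exact measureReal_nonneg
  have hm := measurable_sphereTranslationPoint (n := n) lam
  have hcc := continuous_chord lam
  have hm2 : Measurable fun q : ℝ × Metric.sphere (0 : EuclideanSpace ℝ (Fin n)) 1 =>
      chord lam q.1 • q.2.1 := by fun_prop
  have hfin : IsFiniteMeasure (sphereAngleMeasure γ) := by
    unfold sphereAngleMeasure
    infer_instance
  have hfin2 : IsFiniteMeasure (ENNReal.ofReal (sphereArea γ) •
      ((angleMeasure (polarExponent γ)).prod (weightedSphere γ)).map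
        (fun q => chord lam q.1 • q.2.1)) := Measure.smul_finite _ ENNReal.ofReal_ne_top
  have hK : ∀ η, Measurable fun x => besselKernel γ x η := fun η =>
    (continuous_besselKernel_left hγ η).measurable
  have hKi : ∀ (η : EuclideanSpace ℝ (Fin n)) {X : Type} [MeasurableSpace X] {ρ : Measure X}
      [IsFiniteMeasure ρ] {u : X → EuclideanSpace ℝ (Fin n)}, Measurable u →
      Integrable (fun x => besselKernel γ (u x) η) ρ := by
    intro η X _ ρ _ u hu
    exact (integrable_const (1 : ℝ)).mono' ((hK η).comp hu).aestronglyMeasurable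
      (ae_of_all _ fun x => abs_besselKernel_le hγ _ _)
  rw [← map_chord_smul hn hγ hlam]
  refine ext_of_integral_besselKernel hγ ?_ ?_ fun η => ?_
  · rw [ae_map_iff (p := fun x => x ∈ orthant n) hm.aemeasurable (measurableSet_orthant n)]
    exact ae_sphereAngleMeasure hγ hlam
  · refine Measure.ae_smul_measure ?_ _
    rw [map_chord_smul hn hγ hlam]
    exact (withDensity_absolutelyContinuous _ _).ae_le (ae_orthantMeasure γ)
  · have hsph : ∫ θ : Metric.sphere (0 : EuclideanSpace ℝ (Fin n)) 1, besselKernel γ (lam • θ.1) η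
        ∂weightedSphere γ = sphereArea γ * smallBessel ((polarExponent γ - 1) / 2) (lam * ‖η‖) :=
      integral_weightedSphere_besselKernel hn hγ η hlam
    -- Averaging over the angles splits the kernel into its values at `λξ` and `λζ`, so the double
    -- sphere integral is the square of one spherical mean.
    have h1 : ∫ x, besselKernel γ x η ∂((sphereAngleMeasure γ).map (sphereTranslationPoint lam)) =
        (sphereArea γ * smallBessel ((polarExponent γ - 1) / 2) (lam * ‖η‖)) ^ 2 := by
      rw [integral_map hm.aemeasurable (hK η).aestronglyMeasurable]
      have hi := hKi η (ρ := sphereAngleMeasure γ) hm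
      unfold sphereAngleMeasure at hi ⊢
      rw [integral_prod _ hi]
      simp only [sphereTranslationPoint, integral_besselKernel_translationPoint hγ]
      rw [integral_congr_ae (ae_of_all _ fun x => mul_comm _ _),
        integral_prod_mul (fun ζ : Metric.sphere (0 : EuclideanSpace ℝ (Fin n)) 1 =>
        besselKernel γ (lam • ζ.1) η) (fun ζ : Metric.sphere (0 : EuclideanSpace ℝ (Fin n)) 1 =>
        besselKernel γ (lam • ζ.1) η), hsph, sq]
    -- The product formula with parameter `p` at the equal arguments `λ`, `λ` gives the square
    -- again, but with only one factor of the area; the scalar in front of the measure supplies the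
    -- other.
    have h2 : ∫ q : ℝ × Metric.sphere (0 : EuclideanSpace ℝ (Fin n)) 1,
        besselKernel γ (chord lam q.1 • q.2.1) η
          ∂(angleMeasure (polarExponent γ)).prod (weightedSphere γ) =
        sphereArea γ * smallBessel ((polarExponent γ - 1) / 2) (lam * ‖η‖) ^ 2 := by
      rw [integral_prod _ (hKi η hm2), sq, ← integral_smallBessel_chord hp, ← integral_const_mul]
      refine integral_congr_ae ?_
      filter_upwards [ae_angleMeasure (polarExponent γ)] with φ hφ
      refine integral_weightedSphere_besselKernel hn hγ η (r := chord lam φ) ?_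
      rw [chord_eq hlam hφ]
      have : 0 < Real.sin (φ / 2) :=
        Real.sin_pos_of_pos_of_lt_pi (by linarith [hφ.1]) (by linarith [hφ.2, Real.pi_pos])
      positivity
    rw [h1, integral_smul_measure, integral_map hm2.aemeasurable (hK η).aestronglyMeasurable, h2,
      ENNReal.toReal_ofReal hA, smul_eq_mul]
    ring

end Spheres

/-! ### The reconstruction formula -/

section Reconstruction

variable {n : ℕ} {γ : Fin n → ℝ}

/-- The transform is continuous, bounded by the weighted `L¹` norm of `F`, and vanishes on the
orthant outside a ball of finite measure. -/
theorem integrable_fourierBessel (hγ : ∀ i, 0 < γ i) {F : EuclideanSpace ℝ (Fin n) → ℂ}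
    (hF : Integrable F (orthantMeasure γ)) {r : ℝ}
    (hsupp : ∀ ξ ∈ orthant n, fourierBessel γ F ξ ≠ 0 → ξ ∈ orthantBall n r) :
    Integrable (fourierBessel γ F) (orthantMeasure γ) := by
  have hi : Integrable ((Metric.ball (0 : EuclideanSpace ℝ (Fin n)) r).indicator fun _ =>
      ∫ x, ‖F x‖ ∂orthantMeasure γ) (orthantMeasure γ) :=
    (integrable_indicator_iff measurableSet_ball).2
      (integrableOn_const (orthantMeasure_ball_lt_top hγ 0 r).ne)
  refine hi.mono' (continuous_fourierBessel hγ hF).aestronglyMeasurable ?_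
  filter_upwards [ae_orthantMeasure γ] with ξ hξ
  by_cases h0 : fourierBessel γ F ξ = 0
  · rw [h0, norm_zero]
    exact indicator_nonneg (fun _ _ => integral_nonneg fun _ => norm_nonneg _) _
  · rw [indicator_of_mem (by simpa using (hsupp ξ hξ h0).2)]
    exact norm_fourierBessel_le hγ hF ξ

theorem measurable_ewaldFunction (hγ : ∀ i, 0 < γ i) {G : EuclideanSpace ℝ (Fin n) → ℂ}
    (hG : Measurable G) (lam : ℝ) (y : EuclideanSpace ℝ (Fin n)) :
    Measurable (ewaldFunction γ lam G y) := by
  have hK : Measurable fun x => besselKernel γ x y :=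
    (continuous_besselKernel_left hγ y).measurable
  unfold ewaldFunction
  fun_prop

/-- The reason for the shape of `f_y`: its factor is the reciprocal of the chord density up to a
constant. No cutoff at `2λ` is required in `ewaldFunction`, since `G` already vanishes there. -/
theorem chordDensity_smul_ewaldFunction {lam : ℝ} {G : EuclideanSpace ℝ (Fin n) → ℂ}
    {x : EuclideanSpace ℝ (Fin n)} (hx : 0 < ‖x‖) (hG : G x ≠ 0 → ‖x‖ < 2 * lam)
    (y : EuclideanSpace ℝ (Fin n)) :
    chordDensity (polarExponent γ) lam ‖x‖ • ewaldFunction γ lam G y x =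
      chordConst (polarExponent γ) lam • (besselKernel γ x y • G x) := by
  by_cases h0 : G x = 0
  · simp [ewaldFunction, h0]
  · have hlt := hG h0
    have hpos : 0 < (4 * lam ^ 2 - ‖x‖ ^ 2) ^ ((n + ∑ i, γ i - 3) / 2) := by
      apply Real.rpow_pos_of_pos
      nlinarith
    rw [chordDensity, indicator_of_mem (show ‖x‖ ∈ Iio (2 * lam) from hlt), ewaldFunction,
      show (polarExponent γ - 2) / 2 = (n + ∑ i, γ i - 3) / 2 by unfold polarExponent; ring]
    generalize (4 * lam ^ 2 - ‖x‖ ^ 2) ^ ((n + ∑ i, γ i - 3) / 2) = P at *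
    have h1 : (P : ℂ) ≠ 0 := Complex.ofReal_ne_zero.2 hpos.ne'
    have h2 : (‖x‖ : ℂ) ≠ 0 := Complex.ofReal_ne_zero.2 hx.ne'
    simp only [Complex.real_smul]
    push_cast
    field_simp

theorem inversionConstant_mul (hn : 0 < n) (hγ : ∀ i, 0 < γ i) {lam : ℝ} (hlam : 0 < lam) :
    inversionConstant γ lam * (sphereArea γ * (chordConst (polarExponent γ) lam *
      (2 ^ (∑ i, γ i - n) * (∏ i, Real.Gamma ((γ i + 1) / 2)) ^ 2))) = 1 := by
  have hp := polarExponent_pos hn hγ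
  have hA := sphereArea_mul_Gamma hn hγ
  have hProd : 0 < ∏ i, Real.Gamma ((γ i + 1) / 2) := Finset.prod_pos fun i _ =>
    Real.Gamma_pos_of_pos (by linarith [hγ i])
  have hG1 := Real.Gamma_pos_of_pos (show 0 < (polarExponent γ + 1) / 2 by positivity)
  have hA0 : 0 < sphereArea γ := by
    have : 0 < sphereArea γ * (Real.Gamma ((polarExponent γ + 1) / 2) * 2 ^ n) := by
      rw [← mul_assoc, hA]
      positivity
    exact pos_of_mul_pos_left this (by positivity)
  have e1 : (∑ i, γ i + n - 1) / 2 = polarExponent γ / 2 := by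
    unfold polarExponent
    ring
  have e2 : (n + ∑ i, γ i) / 2 = (polarExponent γ + 1) / 2 := by
    unfold polarExponent
    ring
  have e3 : lam ^ (2 * n + 2 * ∑ i, γ i - 4) * lam ^ (2 - 2 * polarExponent γ) = 1 := by
    rw [← Real.rpow_add hlam, ← Real.rpow_zero lam]
    congr 1
    unfold polarExponent
    ring
  have e4 : (2 : ℝ) ^ ((n : ℝ) - 2) * (2 ^ (2 - polarExponent γ) * 2 ^ (∑ i, γ i - n)) * 2 ^ n =
      2 := by
    rw [← Real.rpow_natCast, ← Real.rpow_add two_pos, ← Real.rpow_add two_pos,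
      ← Real.rpow_add two_pos]
    refine Eq.trans ?_ (Real.rpow_one 2)
    congr 1
    unfold polarExponent
    ring
  rw [inversionConstant, chordConst, angleConst, e1, e2]
  generalize lam ^ (2 * n + 2 * ∑ i, γ i - 4) = L at *
  generalize lam ^ (2 - 2 * polarExponent γ) = M at *
  generalize (2 : ℝ) ^ ((n : ℝ) - 2) = a at *
  generalize (2 : ℝ) ^ (2 - polarExponent γ) = b at *
  generalize (2 : ℝ) ^ (∑ i, γ i - n) = c at *
  generalize Real.Gamma ((polarExponent γ + 1) / 2) = g at *
  generalize ∏ i, Real.Gamma ((γ i + 1) / 2) = P at *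
  generalize sphereArea γ = A at *
  field_simp
  -- The factor `2^n` brings the goal to the form in which `hA`, the area formula, eliminates one
  -- power of the area.
  have h2n : (0 : ℝ) < 2 ^ n := by positivity
  refine mul_right_cancel₀ h2n.ne' ?_
  linear_combination (a * b * c * P * 2 ^ n) * e3 + P * e4 - hA

theorem ae_prod_sphereMeasure (n : ℕ) : ∀ᵐ p ∂(sphereMeasure n).prod (sphereMeasure n),
    p.1.1 ∈ orthant n ∧ p.2.1 ∈ orthant n :=
  (Measure.quasiMeasurePreserving_fst.ae (ae_sphereMeasure n)).and
    (Measure.quasiMeasurePreserving_snd.ae (ae_sphereMeasure n))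

theorem prod_weightedSphere (γ : Fin n → ℝ) : (weightedSphere γ).prod (weightedSphere γ) =
    ((sphereMeasure n).prod (sphereMeasure n)).withDensity fun p =>
      ENNReal.ofReal (weight γ p.1.1) * ENNReal.ofReal (weight γ p.2.1) :=
  prod_withDensity (measurable_weight_sphere γ).ennreal_ofReal
    (measurable_weight_sphere γ).ennreal_ofReal

end Reconstruction

end

end FourierBessel

/-! ### The reconstruction theorem. -/

theorem mainTheorem2 (n : ℕ) (hn : 0 < n) (γ : Fin n → ℝ) (hγ : ∀ i, 0 < γ i)
    (lam : ℝ) (hlam : 0 < lam) (F : EuclideanSpace ℝ (Fin n) → ℂ)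
    (hFcont : ContinuousOn F (orthant n))
    (hFint : IntegrableOn (fun x => (weight γ x : ℂ) * F x) (orthant n))
    (hsupp : ∀ ξ ∈ orthant n, fourierBessel γ F ξ ≠ 0 → ξ ∈ orthantBall n (2 * lam))
    (y : EuclideanSpace ℝ (Fin n)) (hy : y ∈ orthant n) :
    (∀ᵐ p ∂((sphereMeasure n).prod (sphereMeasure n)),
      IntegrableOn
        (translationIntegrand γ (ewaldFunction γ lam (fourierBessel γ F) y)
          (lam • p.1.1) (lam • p.2.1))
        (angleCube n)) ∧
    Integrable
      (fun p : Metric.sphere (0 : EuclideanSpace ℝ (Fin n)) 1 ×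
          Metric.sphere (0 : EuclideanSpace ℝ (Fin n)) 1 =>
        translation γ (ewaldFunction γ lam (fourierBessel γ F) y) (lam • p.1.1) (lam • p.2.1) *
          ((weight γ p.1.1 * weight γ p.2.1 : ℝ) : ℂ))
      ((sphereMeasure n).prod (sphereMeasure n)) ∧
    F y = (inversionConstant γ lam : ℂ) *
      ∫ ζ, ∫ ξ,
        translation γ (ewaldFunction γ lam (fourierBessel γ F) y) (lam • ζ.1) (lam • ξ.1) *
          ((weight γ ζ.1 * weight γ ξ.1 : ℝ) : ℂ)
        ∂(sphereMeasure n) ∂(sphereMeasure n) := by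
  have hp := polarExponent_pos hn hγ
  have := isFiniteMeasure_weightedSphere hγ
  have := fun i => isProbabilityMeasure_angleMeasure (hγ i)
  have hA : 0 ≤ sphereArea γ := by
    rw [← weightedSphere_real_univ]
    exact measureReal_nonneg
  have hF : Integrable F (orthantMeasure γ) := (integrable_orthantMeasure_iff γ F).2
    (hFint.congr (ae_of_all _ fun x => (Complex.real_smul ..).symm))
  have hG := integrable_fourierBessel hγ hF hsupp
  have hinv := integral_besselKernel_smul_fourierBessel hγ hFcont hF hG hy
  have hf := measurable_ewaldFunction hγ (continuous_fourierBessel hγ hF).measurable lam y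
  set f := ewaldFunction γ lam (fourierBessel γ F) y with hfdef
  have hD := measurable_chordDensity (polarExponent γ) lam
  have hDnorm : Measurable fun x : EuclideanSpace ℝ (Fin n) =>
      ENNReal.ofReal (chordDensity (polarExponent γ) lam ‖x‖) := by fun_prop
  have hnorm : ∀ x ∈ orthant n, 0 < ‖x‖ := fun x hx =>
    norm_pos_iff.2 fun h0 => by simpa [h0] using hx ⟨0, hn⟩
  have hsmul : ∀ᵐ x ∂orthantMeasure γ,
      (ENNReal.ofReal (chordDensity (polarExponent γ) lam ‖x‖)).toReal • f x =
        chordConst (polarExponent γ) lam • (besselKernel γ x y • fourierBessel γ F x) := by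
    filter_upwards [ae_orthantMeasure γ] with x hx
    rw [ENNReal.toReal_ofReal (chordDensity_nonneg hp hlam (hnorm x hx)), hfdef,
      chordDensity_smul_ewaldFunction (hnorm x hx) (fun h => (hsupp x hx h).2)]
  have hm := measurable_sphereTranslationPoint (n := n) lam
  have hmap := map_sphereTranslationPoint hn hγ hlam
  -- Integrability is tested on the pushforward: against the isotropic density, `f` becomes a
  -- constant times the bounded kernel times the integrable transform.
  have hint : Integrable (fun q => f (sphereTranslationPoint lam q)) (sphereAngleMeasure γ) := by
    rw [← Function.comp_def f, ← integrable_map_measure hf.aestronglyMeasurable hm.aemeasurable,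
      hmap]
    refine Integrable.smul_measure ?_ ENNReal.ofReal_ne_top
    rw [integrable_withDensity_iff_integrable_smul' hDnorm (by simp), integrable_congr hsmul]
    exact Integrable.smul (chordConst (polarExponent γ) lam) (integrable_besselKernel_smul hγ hG y)
  have hval : ∫ q, f (sphereTranslationPoint lam q) ∂sphereAngleMeasure γ =
      (sphereArea γ * (chordConst (polarExponent γ) lam *
        (2 ^ (∑ i, γ i - n) * (∏ i, Real.Gamma ((γ i + 1) / 2)) ^ 2))) • F y := by
    rw [← integral_map hm.aemeasurable hf.aestronglyMeasurable, hmap, integral_smul_measure,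
      integral_withDensity_eq_integral_toReal_smul hDnorm (by simp), integral_congr_ae hsmul,
      integral_smul, hinv, ENNReal.toReal_ofReal hA, smul_smul, smul_smul, mul_assoc]
  have htr : ∀ p : Metric.sphere (0 : EuclideanSpace ℝ (Fin n)) 1 ×
      Metric.sphere (0 : EuclideanSpace ℝ (Fin n)) 1,
      translation γ f (lam • p.1.1) (lam • p.2.1) = ∫ φ, f (sphereTranslationPoint lam (p, φ))
        ∂Measure.pi fun i => angleMeasure (γ i) := fun p => translation_eq hγ f _ _
  have hwm := measurable_weight_sphere γ
  have hW : Measurable fun p : Metric.sphere (0 : EuclideanSpace ℝ (Fin n)) 1 ×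
      Metric.sphere (0 : EuclideanSpace ℝ (Fin n)) 1 =>
      ENNReal.ofReal (weight γ p.1.1) * ENNReal.ofReal (weight γ p.2.1) :=
    (hwm.comp measurable_fst).ennreal_ofReal.mul (hwm.comp measurable_snd).ennreal_ofReal
  have hWlt : ∀ᵐ p ∂(sphereMeasure n).prod (sphereMeasure n),
      ENNReal.ofReal (weight γ p.1.1) * ENNReal.ofReal (weight γ p.2.1) < ⊤ :=
    ae_of_all _ fun p => ENNReal.mul_lt_top ENNReal.ofReal_lt_top ENNReal.ofReal_lt_top
  have hWsmul : ∀ᵐ p ∂(sphereMeasure n).prod (sphereMeasure n),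
      (ENNReal.ofReal (weight γ p.1.1) * ENNReal.ofReal (weight γ p.2.1)).toReal •
        translation γ f (lam • p.1.1) (lam • p.2.1) =
      translation γ f (lam • p.1.1) (lam • p.2.1) *
        ((weight γ p.1.1 * weight γ p.2.1 : ℝ) : ℂ) := by
    filter_upwards [ae_prod_sphereMeasure n] with p hp
    rw [ENNReal.toReal_mul, ENNReal.toReal_ofReal (weight_pos γ hp.1).le,
      ENNReal.toReal_ofReal (weight_pos γ hp.2).le, Complex.real_smul, mul_comm]
  unfold sphereAngleMeasure at hint hval
  have hint2 : Integrable (fun p : Metric.sphere (0 : EuclideanSpace ℝ (Fin n)) 1 ×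
      Metric.sphere (0 : EuclideanSpace ℝ (Fin n)) 1 =>
        translation γ f (lam • p.1.1) (lam • p.2.1) *
          ((weight γ p.1.1 * weight γ p.2.1 : ℝ) : ℂ))
      ((sphereMeasure n).prod (sphereMeasure n)) := by
    have h1 := hint.integral_prod_left
    simp only [← htr] at h1
    rw [prod_weightedSphere, integrable_withDensity_iff_integrable_smul' hW hWlt,
      integrable_congr hWsmul] at h1
    exact h1
  refine ⟨?_, hint2, ?_⟩
  -- Fubini gives convergence almost everywhere for the weighted measure; this passes to `dS × dS`
  -- because the weights are positive at almost every point.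
  · have h1 := hint.prod_right_ae
    rw [prod_weightedSphere, ae_withDensity_iff hW] at h1
    filter_upwards [h1, ae_prod_sphereMeasure n] with p h1 hp
    refine integrableOn_translationIntegrand hγ (h1 (mul_ne_zero ?_ ?_))
    · exact (ENNReal.ofReal_pos.2 (weight_pos γ hp.1)).ne'
    · exact (ENNReal.ofReal_pos.2 (weight_pos γ hp.2)).ne'
  · rw [integral_prod _ hint] at hval
    simp only [← htr] at hval
    rw [prod_weightedSphere, integral_withDensity_eq_integral_toReal_smul hW hWlt,
      integral_congr_ae hWsmul, integral_prod _ hint2] at hval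
    rw [hval, Complex.real_smul, ← mul_assoc, ← Complex.ofReal_mul,
      inversionConstant_mul hn hγ hlam, Complex.ofReal_one, one_mul]
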